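/- **Lemma (Commutator area).** Let $\mathbb{H}^2$ be the hyperbolic plane, $\overline{\mathbb{H}}^2=\mathbb{H}^2\cup S^1_\infty$ its union with the circle at infinity, and $\widetilde{PSL_2\mathbb{R}}$ the universal covering group of $PSL_2\mathbb{R}=\mathrm{Isom}^+\mathbb{H}^2$, i.e. the group of homotopy classes (relative to endpoints) of paths in $PSL_2\mathbb{R}$ starting at the identity. An element $\tilde\alpha$ projects to the endpoint $\alpha\in PSL_2\mathbb{R}$ of its paths. For $\tilde\alpha\in\widetilde{PSL_2\mathbb{R}}$ and $y\in\mathbb{H}^2$, let $c:[0,1]\to\mathbb{H}^2$ be the constant speed (possibly $0$) geodesic from $y$ to $\alpha y$, and let $V$ be a unit tangent vector field along $c$ in the homotopy class of $\tilde\alpha$, i.e. $V(t)=Dg(t)\,u$, where $u$ is a unit tangent vector at $y$ and $g$ is a path starting at the identity, in the class $\tilde\alpha$, with $g(t)y=c(t)$. Then $\mathrm{Twist}(\tilde\alpha,y)=\theta(1)-\theta(0)\in\mathbb{R}$, where $\theta$ is a continuous determination of the anticlockwise angle from the unit tangent vector of $c$ to $V$ (from a constant vector if $c$ is constant). For $p\in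 S^1_\infty$, $\mathrm{Twist}(\tilde\alpha,p)$ is the limit of $\mathrm{Twist}(\tilde\alpha,x)$ as $x\to p$ along any geodesic with endpoint $p$. Let $\Delta[A,B,C]$ denote the signed hyperbolic area of the geodesic triangle with ordered vertices $A,B,C\in\overline{\mathbb{H}}^2$ (positive if the vertices are in anticlockwise order, negative if clockwise, $0$ if degenerate). Let $[x,y]=xyx^{-1}y^{-1}$. For all $\tilde\alpha,\tilde\beta\in\widetilde{PSL_2\mathbb{R}}$ with images $\alpha,\beta\in PSL_2\mathbb{R}$, and all $p\in\overline{\mathbb{H}}^2$, $$\mathrm{Twist}\big([\tilde\alpha,\tilde\beta],p\big)=\Delta[p,\beta p,\beta\alpha p]-\Delta[p,\alpha p,\alpha\beta p]-\Delta\big[p,\alpha\beta p,[\alpha,\beta]p\big].$$ Consequently $\big|\mathrm{Twist}([\tilde\alpha,\tilde\beta],p)\big|<3\pi$ for $p\in\mathbb{H}^2$, and $\big|\mathrm{Twist}([\tilde\alpha,\tilde\beta],p)\big|\le 3\pi$ for $p\in S^1_\infty$. -/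

import Mathlib

open UpperHalfPlane MeasureTheory Filter Topology
open scoped unitInterval MatrixGroups

noncomputable section

namespace HypTwist

/-! ### The universal covering group, as homotopy classes of paths -/

section UniversalCover

variable (G : Type*) [Group G] [TopologicalSpace G] [IsTopologicalGroup G]

/-- The group, under pointwise multiplication, of continuous paths `[0,1] → G` issuing from `1`. -/
def BasedPaths : Subgroup C(I, G) where
  carrier := {c | c 0 = 1}
  mul_mem' := by
    intro a b ha hb
    have ha' : a 0 = 1 := ha
    have hb' : b 0 = 1 := hb
    simp [ha', hb']
  one_mem' := by simp
  inv_mem' := by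
    intro a ha
    have ha' : a 0 = 1 := ha
    simp [ha']

/-- Homotopy relative to the endpoints, a congruence on the group of based paths. -/
def homotopyCon : Con (BasedPaths G) where
  r a b := (a : C(I, G)).HomotopicRel (b : C(I, G)) {0, 1}
  iseqv :=
    ⟨fun a => ContinuousMap.HomotopicRel.refl _, fun h => h.symm, fun h k => h.trans k⟩
  mul' := by
    rintro a b c d ⟨F⟩ ⟨H⟩
    refine ⟨⟨⟨F.toContinuousMap * H.toContinuousMap, ?_, ?_⟩, ?_⟩⟩
    · intro x
      simp
    · intro x
      simp
    · intro t x hx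
      have h1 := F.eq_fst t hx
      have h2 := H.eq_fst t hx
      simpa using! congrArg₂ (· * ·) h1 h2

/-- The universal covering group of a (connected Lie) group `G`: homotopy classes, relative to the
endpoints, of paths issuing from the identity, multiplied pointwise. -/
abbrev UniversalCover : Type _ := (homotopyCon G).Quotient

variable {G}

/-- The element of the universal covering group represented by a based path. -/
def UniversalCover.mk (c : BasedPaths G) : UniversalCover G := (c : (homotopyCon G).Quotient)

/-- The covering homomorphism: a class of paths is sent to the common endpoint of these paths. -/
def UniversalCover.proj : UniversalCover G →* G :=
  (homotopyCon G).lift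
    { toFun := fun c => (c : C(I, G)) 1
      map_one' := by simp
      map_mul' := fun a b => by simp }
    (by
      intro a b h
      have h' : (a : C(I, G)).HomotopicRel (b : C(I, G)) {0, 1} := h
      exact h'.fst_eq_snd (by simp))

end UniversalCover

/-! ### The closed hyperbolic plane and the action of `PSL(2, ℝ)` -/

theorem center_smul_eq (g : SL(2, ℝ)) (hg : g ∈ Subgroup.center SL(2, ℝ)) (z : ℍ) :
    g • z = z := by
  obtain ⟨r, hr, hrg⟩ := Matrix.SpecialLinearGroup.mem_center_iff.mp hg
  have hr0 : r ≠ 0 := by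
    rintro rfl
    simp at hr
  have hr1 : (r : ℂ) ≠ 0 := by exact_mod_cast hr0
  have e : ∀ i j, g i j = (Matrix.scalar (Fin 2) r) i j := fun i j => by rw [hrg]
  ext1
  rw [coe_specialLinearGroup_apply]
  simp [e, hr1]

/-- The action of `SL(2, ℝ)` on `ℝ ∪ {∞}` by fractional linear transformations. -/
def slPermBoundary : SL(2, ℝ) →* Equiv.Perm (OnePoint ℝ) :=
  (MulAction.toPermHom (GL (Fin 2) ℝ) (OnePoint ℝ)).comp
    (Matrix.SpecialLinearGroup.mapGL ℝ)

theorem center_boundary_eq (g : SL(2, ℝ)) (hg : g ∈ Subgroup.center SL(2, ℝ)) :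
    slPermBoundary g = 1 := by
  obtain ⟨r, hr, hrg⟩ := Matrix.SpecialLinearGroup.mem_center_iff.mp hg
  have hr0 : r ≠ 0 := by
    rintro rfl
    simp at hr
  have e : ∀ i j, g i j = (Matrix.scalar (Fin 2) r) i j := fun i j => by rw [hrg]
  ext1 x
  change (Matrix.SpecialLinearGroup.mapGL ℝ g) • x = x
  cases x with
  | infty => simp [OnePoint.smul_infty_eq_ite, e]
  | coe x => simp [OnePoint.smul_some_eq_ite, e, hr0]

/-- The action of `PSL(2, ℝ)` on the upper half-plane by fractional linear transformations. -/
instance instActionPlane : MulAction PSL(2, ℝ) ℍ :=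
  MulAction.compHom ℍ
    (QuotientGroup.lift (Subgroup.center SL(2, ℝ)) (MulAction.toPermHom SL(2, ℝ) ℍ)
      (fun g hg => Equiv.ext (center_smul_eq g hg)))

/-- The action of `PSL(2, ℝ)` on the circle at infinity `ℝ ∪ {∞}`. -/
instance instActionBoundary : MulAction PSL(2, ℝ) (OnePoint ℝ) :=
  MulAction.compHom (OnePoint ℝ)
    (QuotientGroup.lift (Subgroup.center SL(2, ℝ)) slPermBoundary center_boundary_eq)

/-- The closed hyperbolic plane: the upper half-plane together with its circle at infinity. The
group `PSL(2, ℝ)` acts on both parts. -/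
abbrev ClosedPlane : Type := ℍ ⊕ OnePoint ℝ

/-! ### Tangent vectors and geodesics

The tangent space of `ℍ` at every point is `ℂ`; a tangent vector `v` at `z` has hyperbolic length
`‖v‖ / im z`, and the hyperbolic angle between two vectors at a point is the Euclidean one. -/

/-- The differential of the isometry `g` at `z`, applied to the tangent vector `v`. -/
def differential (g : PSL(2, ℝ)) (z : ℍ) (v : ℂ) : ℂ :=
  deriv (fun w : ℂ => ((g • (ofComplex w : ℍ) : ℍ) : ℂ)) (z : ℂ) * v

/-- The point `e ^ s * i` of the imaginary axis, the unit speed geodesic from `0` to `∞`. -/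
def axisPoint (s : ℝ) : ℍ := ⟨Complex.I * (Real.exp s : ℂ), by
  rw [Complex.I_mul_im, Complex.ofReal_re]
  exact Real.exp_pos s⟩

/-- The complete unit speed geodesic `s ↦ h • (e ^ s * i)`; every unit speed geodesic of `ℍ` is of
this form. Its endpoint as `s → ∞` is `h • ∞`. -/
def geodesic (h : PSL(2, ℝ)) (s : ℝ) : ℍ := h • axisPoint s

/-- The unit tangent vector of the geodesic `geodesic h` at time `s`: the image under `h` of the
velocity `e ^ s * i` of the imaginary axis. -/
def geodesicTangent (h : PSL(2, ℝ)) (s : ℝ) : ℂ :=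
  differential h (axisPoint s) (Complex.I * (Real.exp s : ℂ))

/-! ### Twist -/

/-- `T` is the twist of `a` at the point `y` of `ℍ`. The map `t ↦ geodesic h (d * t)` is the
constant speed geodesic `[0,1] → ℍ` from `y` to the image of `y`, and `V t = D(c t) u` is a unit
tangent vector field along it, where the path `c` from the identity represents `a`, i.e. `V` lies in
the homotopy class `a`. The function `θ` is a continuous determination of the angle, measured
anticlockwise, from the unit tangent vector of the geodesic to `V`, and `T` is its total change
`θ 1 - θ 0`. (If the speed `d` is `0`, then the reference vector `geodesicTangent h 0` is constant.) -/
def IsTwistAt (a : UniversalCover PSL(2, ℝ)) (y : ℍ) (T : ℝ) : Prop :=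
  ∃ (c : BasedPaths PSL(2, ℝ)) (h : PSL(2, ℝ)) (d : ℝ) (u : ℂ) (θ : C(I, ℝ)),
    UniversalCover.mk c = a ∧ 0 ≤ d ∧ ‖u‖ = y.im ∧
    (∀ t : I, (c : C(I, PSL(2, ℝ))) t • y = geodesic h (d * t)) ∧
    (∀ t : I, differential ((c : C(I, PSL(2, ℝ))) t) y u =
      Complex.exp (Complex.I * (θ t : ℂ)) * geodesicTangent h (d * t)) ∧
    T = θ 1 - θ 0

/-- The twist of `a` at a point of `ℍ`: the unique real number `T` with `IsTwistAt a y T`. -/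
def twistInterior (a : UniversalCover PSL(2, ℝ)) (y : ℍ) : ℝ :=
  Classical.epsilon (IsTwistAt a y)

/-- `T` is the limit of the twist of `a` along every geodesic with endpoint `q` at infinity. -/
def IsTwistAtInfinity (a : UniversalCover PSL(2, ℝ)) (q : OnePoint ℝ) (T : ℝ) : Prop :=
  ∀ h : PSL(2, ℝ), h • (OnePoint.infty : OnePoint ℝ) = q →
    Tendsto (fun s : ℝ => twistInterior a (geodesic h s)) atTop (𝓝 T)

/-- The twist of `a` at a point of the closed hyperbolic plane. -/
def twist (a : UniversalCover PSL(2, ℝ)) : ClosedPlane → ℝ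
  | .inl y => twistInterior a y
  | .inr q => Classical.epsilon (IsTwistAtInfinity a q)

/-! ### Signed area of triangles -/

/-- The coordinates `(1 : re z : |z|²)` in the projective model; geodesics are the sections of `ℍ` by
planes through the origin. The ideal points `x` and `∞` are `(1 : x : x²)` and `(0 : 0 : 1)`. -/
def projCoord : ClosedPlane → Fin 3 → ℝ
  | .inl z => ![1, z.re, Complex.normSq (z : ℂ)]
  | .inr none => ![0, 0, 1]
  | .inr (some x) => ![1, x, x ^ 2]

/-- Positive if `A`, `B`, `C` are in anticlockwise order (i.e. `C` lies to the left of the oriented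
geodesic from `A` to `B`), negative if they are in clockwise order, and zero if they lie on a common
geodesic or two of them coincide. -/
def orientation (A B C : ClosedPlane) : ℝ :=
  Matrix.det ![projCoord A, projCoord B, projCoord C]

/-- The points of `ℍ` lying strictly to the left of each of the geodesics `A → B`, `B → C`, `C → A`.
This is the open triangle with vertices `A`, `B`, `C` if these are in anticlockwise order, and
empty otherwise. -/
def leftTriangle (A B C : ClosedPlane) : Set ℍ :=
  {z | 0 < orientation A B (.inl z) ∧ 0 < orientation B C (.inl z) ∧
    0 < orientation C A (.inl z)}

/-- The signed hyperbolic area of the geodesic triangle with ordered vertices `A`, `B`, `C` in the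
closed hyperbolic plane: its area `∫ dx dy / y²` if `A`, `B`, `C` are in anticlockwise order, minus
its area if they are in clockwise order, and `0` if the triangle is degenerate. -/
def signedArea (A B C : ClosedPlane) : ℝ :=
  (volume (leftTriangle A B C)).toReal - (volume (leftTriangle A C B)).toReal

end HypTwist

end

noncomputable section

namespace HypTwist

/-! ### The action on the plane and its derivative -/

/-! The proof rests on a product formula for the twist whose defect is an area. For `z`, `w` in the
plane, `kernel z w` is `(z - conj w) / i`; under an isometry `g` its square is multiplied by `g'(z)
* conj (g'(w))` (`kernel_smul_sq`). Its real part is positive, so its argument `halfAngle` is a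
continuous real-valued function, and twice this argument is the rotation of parallel transport from
`w` to `z`. Every angle can therefore be compared as a real number instead of modulo `2π`.

Let `rot a y` be the total rotation of the derivative at `y` along a path representing `a`. The
kernel identity and the chain rule show how it depends on the base point (`rot_change`) and on
products (`rot_mul`). The tangent of the geodesic from `y` to its image turns by twice the
half-angle, so the twist is `rot` minus that amount (`twistInterior_eq`). Consequently the twist of
`a * b` is the sum of the twists minus `triangleAngle`, the holonomy around the triangle `y`, `αy`,
`αβy`.

The holonomy equals the signed area (`signedArea_inl`), a form of Gauss-Bonnet. With a vertex at `∞`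
the area is an integral evaluated by `arcsin`; in general one side is moved onto the imaginary axis
and the triangle becomes a difference of two triangles with vertex `∞`. At ideal points the product
formula is obtained by passing to the limit along geodesics (`twist_mul`).

Finally `[a, b] * (b * a) = a * b`: applying the product formula to this product, to `a * b` and to
`b * a`, the individual twists of `a` and `b` cancel and three areas remain. Each has absolute value
less than `π` for a vertex in the plane and at most `π` for an ideal one. -/

theorem mk_smul_plane (g : SL(2, ℝ)) (z : ℍ) : (QuotientGroup.mk g : PSL(2, ℝ)) • z = g • z := rfl

theorem coe_mk_smul (g : SL(2, ℝ)) (z : ℍ) : (((QuotientGroup.mk g : PSL(2, ℝ)) • z : ℍ) : ℂ) =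
    ((g 0 0 : ℝ) * (z : ℂ) + (g 0 1 : ℝ)) / ((g 1 0 : ℝ) * (z : ℂ) + (g 1 1 : ℝ)) := by
  rw [mk_smul_plane, coe_specialLinearGroup_apply]
  simp

theorem denom_ne (g : SL(2, ℝ)) (z : ℍ) : ((g 1 0 : ℝ) * (z : ℂ) + (g 1 1 : ℝ)) ≠ 0 := by
  have := UpperHalfPlane.denom_ne_zero (Matrix.SpecialLinearGroup.mapGL ℝ g) z
  simpa [UpperHalfPlane.denom] using this

theorem sl_det (g : SL(2, ℝ)) : g 0 0 * g 1 1 - g 0 1 * g 1 0 = 1 := by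
  have := g.det_coe
  rwa [Matrix.det_fin_two] at this

theorem sl_det_complex (g : SL(2, ℝ)) :
    ((g 0 0 : ℝ) : ℂ) * (g 1 1 : ℝ) - (g 0 1 : ℝ) * (g 1 0 : ℝ) = 1 := by
  exact_mod_cast sl_det g

/-- The complex derivative of the isometry `g` at `z`. -/
def derivFactor (g : PSL(2, ℝ)) (z : ℍ) : ℂ :=
  deriv (fun w : ℂ => ((g • (ofComplex w : ℍ) : ℍ) : ℂ)) (z : ℂ)

theorem differential_eq (g : PSL(2, ℝ)) (z : ℍ) (v : ℂ) :
    differential g z v = derivFactor g z * v := rfl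

theorem derivFactor_mk (g : SL(2, ℝ)) (z : ℍ) :
    derivFactor (QuotientGroup.mk g) z = 1 / ((g 1 0 : ℝ) * (z : ℂ) + (g 1 1 : ℝ)) ^ 2 := by
  have hev : (fun w : ℂ => (((QuotientGroup.mk g : PSL(2, ℝ)) • (ofComplex w : ℍ) : ℍ) : ℂ)) =ᶠ[𝓝 (z : ℂ)]
      fun w => ((g 0 0 : ℝ) * w + (g 0 1 : ℝ)) / ((g 1 0 : ℝ) * w + (g 1 1 : ℝ)) := by
    filter_upwards [isOpen_upperHalfPlaneSet.mem_nhds z.im_pos] with w hw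
    rw [coe_mk_smul, ofComplex_apply_of_im_pos hw]
  have h0 := denom_ne g z
  have h1 : HasDerivAt (fun w : ℂ => ((g 0 0 : ℝ) * w + (g 0 1 : ℝ)) / ((g 1 0 : ℝ) * w + (g 1 1 : ℝ)))
      ((((g 0 0 : ℝ) * 1 : ℂ) * ((g 1 0 : ℝ) * (z : ℂ) + (g 1 1 : ℝ)) -
        ((g 0 0 : ℝ) * (z : ℂ) + (g 0 1 : ℝ)) * ((g 1 0 : ℝ) * 1)) /
        ((g 1 0 : ℝ) * (z : ℂ) + (g 1 1 : ℝ)) ^ 2) (z : ℂ) :=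
    (((hasDerivAt_id _).const_mul _).add_const _).div (((hasDerivAt_id _).const_mul _).add_const _) h0
  rw [derivFactor, hev.deriv_eq, h1.deriv]
  congr 1
  linear_combination sl_det_complex g

theorem derivFactor_ne_zero (g : PSL(2, ℝ)) (z : ℍ) : derivFactor g z ≠ 0 := by
  induction g using QuotientGroup.induction_on with | H g
  rw [derivFactor_mk]
  exact one_div_ne_zero (pow_ne_zero 2 (denom_ne g z))

theorem derivFactor_mul (g h : PSL(2, ℝ)) (z : ℍ) :
    derivFactor (g * h) z = derivFactor g (h • z) * derivFactor h z := by
  induction g using QuotientGroup.induction_on with | H g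
  induction h using QuotientGroup.induction_on with | H h
  have h1 := denom_ne h z
  have e : ((h • z : ℍ) : ℂ) = ((h 0 0 : ℝ) * (z : ℂ) + (h 0 1 : ℝ)) / ((h 1 0 : ℝ) * (z : ℂ) + (h 1 1 : ℝ)) :=
    coe_mk_smul h z
  rw [← QuotientGroup.mk_mul, derivFactor_mk, derivFactor_mk, derivFactor_mk, mk_smul_plane, e,
    div_mul_div_comm, ← mul_pow, one_mul]
  congr 2
  simp only [Matrix.SpecialLinearGroup.coe_mul, Matrix.mul_apply, Fin.sum_univ_two]
  push_cast
  field_simp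
  ring

theorem derivFactor_one (z : ℍ) : derivFactor 1 z = 1 := by
  rw [← QuotientGroup.mk_one, derivFactor_mk]
  simp

/-- The two-point function `(z - conj w) / i`, of positive real part on `ℍ`. -/
def kernel (z w : ℂ) : ℂ := ⟨z.im + w.im, w.re - z.re⟩

theorem kernel_eq (z w : ℂ) : kernel z w = -Complex.I * (z - (starRingEnd ℂ) w) := by
  apply Complex.ext <;> simp [kernel]

/-- Real entries and determinant `1` give `gz - conj (gw) = (z - conj w) / ((cz + d)(c conj w +
d))`, and the derivative is `(cz + d)⁻²`. Squaring removes the sign ambiguity of a lift to `SL(2,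
ℝ)`. -/
theorem kernel_smul_sq (g : PSL(2, ℝ)) (z w : ℍ) :
    kernel (g • z : ℍ) (g • w : ℍ) ^ 2 =
      kernel z w ^ 2 * derivFactor g z * (starRingEnd ℂ) (derivFactor g w) := by
  induction g using QuotientGroup.induction_on with | H g
  rw [derivFactor_mk, derivFactor_mk, kernel_eq, kernel_eq, coe_mk_smul, coe_mk_smul]
  have h1 := denom_ne g z
  have h2 := denom_ne g w
  have h3 : ((g 1 0 : ℝ) * (starRingEnd ℂ) (w : ℂ) + (g 1 1 : ℝ)) ≠ 0 := by
    intro h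
    apply h2
    have := congrArg (starRingEnd ℂ) h
    simpa using this
  simp only [map_div₀, map_add, map_mul, Complex.conj_ofReal, map_one, map_pow]
  have key : ((g 0 0 : ℝ) * (z : ℂ) + (g 0 1 : ℝ)) / ((g 1 0 : ℝ) * (z : ℂ) + (g 1 1 : ℝ)) -
      ((g 0 0 : ℝ) * (starRingEnd ℂ) (w : ℂ) + (g 0 1 : ℝ)) / ((g 1 0 : ℝ) * (starRingEnd ℂ) (w : ℂ) + (g 1 1 : ℝ)) =
      (z - (starRingEnd ℂ) (w : ℂ)) / (((g 1 0 : ℝ) * (z : ℂ) + (g 1 1 : ℝ)) *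
        ((g 1 0 : ℝ) * (starRingEnd ℂ) (w : ℂ) + (g 1 1 : ℝ))) := by
    rw [div_sub_div _ _ h1 h3]
    congr 1
    linear_combination (z - (starRingEnd ℂ) (w : ℂ)) * sl_det_complex g
  rw [key]
  field_simp

theorem kernel_self (z : ℍ) : kernel z z = (2 * z.im : ℝ) := by
  apply Complex.ext <;> simp [kernel, two_mul]

/-- This is the diagonal case of the kernel identity, where the kernel is twice the imaginary part.
-/
theorem norm_derivFactor (g : PSL(2, ℝ)) (z : ℍ) : ‖derivFactor g z‖ = (g • z).im / z.im := by
  have h := congrArg norm (kernel_smul_sq g z z)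
  rw [kernel_self, kernel_self, norm_mul, norm_mul, norm_pow, norm_pow, Complex.norm_conj,
    Complex.norm_real, Complex.norm_real, Real.norm_eq_abs, Real.norm_eq_abs, sq_abs, sq_abs] at h
  have hz := z.im_pos
  have hw := (g • z).im_pos
  rw [eq_div_iff hz.ne']
  refine (sq_eq_sq₀ (by positivity) hw.le).mp ?_
  linear_combination -h / 4

theorem continuous_entry (i j : Fin 2) : Continuous fun g : SL(2, ℝ) => g i j :=
  (continuous_apply_apply i j).comp continuous_subtype_val

theorem continuous_derivFactor (z : ℍ) : Continuous fun g : PSL(2, ℝ) => derivFactor g z := by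
  refine (QuotientGroup.isQuotientMap_mk (Subgroup.center SL(2, ℝ))).continuous_iff.mpr ?_
  have h : ((fun g : PSL(2, ℝ) => derivFactor g z) ∘ QuotientGroup.mk) =
      fun g : SL(2, ℝ) => 1 / ((g 1 0 : ℝ) * (z : ℂ) + (g 1 1 : ℝ)) ^ 2 :=
    funext fun g => derivFactor_mk g z
  rw [h]
  refine continuous_const.div ?_ fun g => pow_ne_zero 2 (denom_ne g z)
  have h0 := continuous_entry 1 0
  have h1 := continuous_entry 1 1
  fun_prop

theorem continuous_smul_const (z : ℍ) : Continuous fun g : PSL(2, ℝ) => g • z := by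
  refine UpperHalfPlane.isEmbedding_coe.continuous_iff.mpr ?_
  refine (QuotientGroup.isQuotientMap_mk (Subgroup.center SL(2, ℝ))).continuous_iff.mpr ?_
  have h : ((UpperHalfPlane.coe ∘ fun g : PSL(2, ℝ) => g • z) ∘ QuotientGroup.mk) =
      fun g : SL(2, ℝ) => ((g 0 0 : ℝ) * (z : ℂ) + (g 0 1 : ℝ)) / ((g 1 0 : ℝ) * (z : ℂ) + (g 1 1 : ℝ)) :=
    funext fun g => coe_mk_smul g z
  rw [h]
  have h00 := continuous_entry 0 0
  have h01 := continuous_entry 0 1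
  have h0 := continuous_entry 1 0
  have h1 := continuous_entry 1 1
  exact Continuous.div (by fun_prop) (by fun_prop) fun g => denom_ne g z

/-- Fixing `i` forces `a = d` and `b = -c`; derivative `1` says `(ci + d)² = 1`, so `c = 0` and the
matrix is the scalar `±1`. -/
theorem eq_one_of_fixes_frame (g : PSL(2, ℝ)) (h : g • UpperHalfPlane.I = UpperHalfPlane.I)
    (h' : derivFactor g UpperHalfPlane.I = 1) : g = 1 := by
  induction g using QuotientGroup.induction_on with | H g
  have e := coe_mk_smul g UpperHalfPlane.I
  have hd := denom_ne g UpperHalfPlane.I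
  rw [h, eq_div_iff hd] at e
  rw [derivFactor_mk, div_eq_one_iff_eq (pow_ne_zero 2 hd)] at h'
  have e1 := congrArg Complex.re e
  have e2 := congrArg Complex.im e
  have e3 := congrArg Complex.re h'
  have e4 := congrArg Complex.im h'
  simp [pow_two] at e1 e2 e3 e4
  have hdet := sl_det g
  have hc : g 1 0 = 0 := by
    by_contra hc
    have hd : g 1 1 = 0 := by
      rcases mul_eq_zero.mp (show g 1 0 * g 1 1 = 0 by linarith) with h | h
      · exact absurd h hc
      · exact h
    nlinarith [sq_nonneg (g 1 0)]
  have hb : g 0 1 = 0 := by linarith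
  rw [QuotientGroup.eq_one_iff, Matrix.SpecialLinearGroup.mem_center_iff]
  refine ⟨g 1 1, ?_, ?_⟩
  · rw [hc] at e3
    simp only [Fintype.card_fin]
    linarith
  · ext i j
    fin_cases i <;> fin_cases j <;> simp [hc, hb, e2]

/-! ### Frames -/

/-- The lift to `SL(2, ℝ)` of the rotation about `i` by the angle `φ`. -/
def rotation (φ : ℝ) : SL(2, ℝ) :=
  ⟨!![Real.cos (φ / 2), Real.sin (φ / 2); -Real.sin (φ / 2), Real.cos (φ / 2)], by
    rw [Matrix.det_fin_two_of]
    linear_combination Real.cos_sq_add_sin_sq (φ / 2)⟩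

theorem rotation_smul_I (φ : ℝ) : (QuotientGroup.mk (rotation φ) : PSL(2, ℝ)) • UpperHalfPlane.I =
    UpperHalfPlane.I := by
  apply UpperHalfPlane.ext
  rw [coe_mk_smul, div_eq_iff (denom_ne _ _)]
  apply Complex.ext <;> simp [rotation, add_comm]

theorem derivFactor_rotation (φ : ℝ) :
    derivFactor (QuotientGroup.mk (rotation φ)) UpperHalfPlane.I = Complex.exp (Complex.I * φ) := by
  rw [derivFactor_mk, one_div, inv_eq_iff_eq_inv, ← Complex.exp_neg]
  have : -(Complex.I * φ) = (2 : ℕ) * ((-(φ / 2) : ℝ) * Complex.I) := by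
    push_cast; ring
  rw [this, Complex.exp_nat_mul, Complex.exp_ofReal_mul_I]
  congr 1
  simp [rotation]
  exact add_comm _ _

theorem derivFactor_toSL2R (w : ℍ) :
    derivFactor (QuotientGroup.mk w.toSL2R) UpperHalfPlane.I = (w.im : ℂ) := by
  rw [derivFactor_mk]
  have := w.im_pos
  simp [UpperHalfPlane.coe_toSL2R]
  rw [← Complex.ofReal_pow, Real.sq_sqrt this.le]

theorem derivFactor_inv (g : PSL(2, ℝ)) (z : ℍ) :
    derivFactor g⁻¹ z * derivFactor g (g⁻¹ • z) = 1 := by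
  have h := derivFactor_mul g g⁻¹ z
  rw [mul_inv_cancel, derivFactor_one] at h
  rw [h]
  ring

/-- The isometry sending `y` to `w` whose differential at `y` is a positive multiple of `e ^ (iφ)`. -/
def frame (y w : ℍ) (φ : ℝ) : PSL(2, ℝ) := QuotientGroup.mk (w.toSL2R * rotation φ * y.toSL2R⁻¹)

theorem toSL2R_inv_smul (y : ℍ) :
    (QuotientGroup.mk y.toSL2R⁻¹ : PSL(2, ℝ)) • y = UpperHalfPlane.I := by
  rw [mk_smul_plane, inv_smul_eq_iff, toSL2R_smul_I]

theorem frame_smul (y w : ℍ) (φ : ℝ) : frame y w φ • y = w := by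
  rw [frame, QuotientGroup.mk_mul, QuotientGroup.mk_mul, mul_smul, mul_smul, toSL2R_inv_smul,
    rotation_smul_I, mk_smul_plane, toSL2R_smul_I]

theorem derivFactor_toSL2R_inv (y : ℍ) :
    derivFactor (QuotientGroup.mk y.toSL2R⁻¹) y = (y.im : ℂ)⁻¹ := by
  have h := derivFactor_inv (QuotientGroup.mk y.toSL2R) y
  rw [← QuotientGroup.mk_inv, toSL2R_inv_smul, derivFactor_toSL2R] at h
  exact eq_inv_of_mul_eq_one_left h

theorem derivFactor_frame (y w : ℍ) (φ : ℝ) :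
    derivFactor (frame y w φ) y = (w.im / y.im : ℝ) * Complex.exp (Complex.I * φ) := by
  rw [frame, QuotientGroup.mk_mul, QuotientGroup.mk_mul, derivFactor_mul, derivFactor_mul,
    toSL2R_inv_smul, rotation_smul_I, derivFactor_rotation, derivFactor_toSL2R,
    derivFactor_toSL2R_inv]
  push_cast
  ring

/-- An isometry is determined by its 1-jet at one point: `h⁻¹ * g` is conjugated to an isometry with
trivial 1-jet at `i`. -/
theorem eq_of_smul_eq_of_derivFactor_eq (g h : PSL(2, ℝ)) (y : ℍ) (e : g • y = h • y)
    (e' : derivFactor g y = derivFactor h y) : g = h := by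
  set k : PSL(2, ℝ) := QuotientGroup.mk y.toSL2R with hk
  have hkI : k • UpperHalfPlane.I = y := toSL2R_smul_I y
  have hfix : (h⁻¹ * g) • y = y := by rw [mul_smul, e, inv_smul_smul]
  have hder : derivFactor (h⁻¹ * g) y = 1 := by
    rw [derivFactor_mul, e, e']
    have := derivFactor_mul h⁻¹ h y
    rw [← this, inv_mul_cancel, derivFactor_one]
  have : k⁻¹ * (h⁻¹ * g) * k = 1 := by
    apply eq_one_of_fixes_frame
    · rw [mul_smul, mul_smul, hkI, hfix, ← hkI, inv_smul_smul]
    · rw [derivFactor_mul, derivFactor_mul, hkI, hder, hfix, mul_one]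
      have := derivFactor_mul k⁻¹ k UpperHalfPlane.I
      rw [hkI, inv_mul_cancel, derivFactor_one] at this
      exact this.symm
  have h2 : h⁻¹ * g = 1 := by
    have h3 : k * (k⁻¹ * (h⁻¹ * g) * k) * k⁻¹ = k * 1 * k⁻¹ := by rw [this]
    simpa [mul_assoc] using h3
  rw [inv_mul_eq_one] at h2
  exact h2.symm

theorem eq_frame (g : PSL(2, ℝ)) (y : ℍ) (φ : ℝ)
    (h : derivFactor g y = ‖derivFactor g y‖ * Complex.exp (Complex.I * φ)) :
    g = frame y (g • y) φ := by
  refine eq_of_smul_eq_of_derivFactor_eq _ _ y (frame_smul _ _ _).symm ?_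
  rw [h, derivFactor_frame, norm_derivFactor]

theorem continuous_toSL2R : Continuous fun w : ℍ => w.toSL2R := by
  refine Continuous.subtype_mk (f := fun w : ℍ => (w.toSL2R : Matrix (Fin 2) (Fin 2) ℝ)) ?_ _
  simp only [UpperHalfPlane.coe_toSL2R]
  have h : ∀ w : ℍ, √w.im ≠ 0 := fun w => (Real.sqrt_pos.mpr w.im_pos).ne'
  have h1 : Continuous fun w : ℍ => w.im := UpperHalfPlane.continuous_im
  have h2 : Continuous fun w : ℍ => w.re := UpperHalfPlane.continuous_re
  refine continuous_matrix fun i j => ?_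
  fin_cases i <;> fin_cases j <;> simp
  · exact h1.sqrt
  · exact h2.div h1.sqrt h
  · exact continuous_const
  · exact h1.sqrt.inv₀ h

theorem continuous_rotation : Continuous rotation := by
  refine Continuous.subtype_mk ?_ _
  refine continuous_matrix fun i j => ?_
  fin_cases i <;> fin_cases j <;> simp <;> fun_prop

theorem continuous_frame (y : ℍ) : Continuous fun p : ℍ × ℝ => frame y p.1 p.2 := by
  refine QuotientGroup.continuous_mk.comp ?_
  exact ((continuous_toSL2R.comp continuous_fst).mul (continuous_rotation.comp continuous_snd)).mul
    continuous_const

/-! ### The angle between a geodesic segment and parallel transport -/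

/-- Half the angle by which the parallel transport along the geodesic from `w` to `z` rotates. -/
def halfAngle (z w : ℂ) : ℝ := (kernel z w).arg

theorem kernel_re_pos (z w : ℍ) : 0 < (kernel z w).re := add_pos z.im_pos w.im_pos

theorem kernel_ne_zero (z w : ℍ) : kernel z w ≠ 0 := fun h => by
  have := kernel_re_pos z w
  rw [h] at this
  exact lt_irrefl _ this

theorem kernel_sq_eq (z w : ℂ) :
    kernel z w ^ 2 = (‖kernel z w‖ ^ 2 : ℝ) * Complex.exp (Complex.I * (2 * halfAngle z w : ℝ)) := by
  conv_lhs => rw [← Complex.norm_mul_exp_arg_mul_I (kernel z w)]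
  rw [mul_pow, ← Complex.exp_nat_mul, halfAngle]
  push_cast
  congr 2
  ring

/-- The kernel is Hermitian, and positivity of its real part excludes the exceptional argument `π`.
-/
theorem halfAngle_swap (z w : ℍ) : halfAngle w z = -halfAngle z w := by
  have h : kernel w z = (starRingEnd ℂ) (kernel z w) := by
    apply Complex.ext <;> simp [kernel, add_comm]
  rw [halfAngle, h, Complex.arg_conj, if_neg, halfAngle]
  intro h'
  have := (Complex.arg_eq_pi_iff.mp h').1
  exact absurd (kernel_re_pos z w) this.le.not_gt

theorem halfAngle_self (z : ℍ) : halfAngle z z = 0 := by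
  linarith [halfAngle_swap z z]

theorem continuous_kernel : Continuous fun p : ℂ × ℂ => kernel p.1 p.2 := by
  simp only [kernel_eq]
  fun_prop

theorem Continuous.halfAngle {X : Type*} [TopologicalSpace X] {f g : X → ℍ} (hf : Continuous f)
    (hg : Continuous g) : Continuous fun x => halfAngle (f x) (g x) := by
  refine continuous_iff_continuousAt.mpr fun x => ?_
  refine ContinuousAt.comp (f := fun x => kernel (f x) (g x)) (g := Complex.arg)
    (Complex.continuousAt_arg ?_) ?_
  · exact Complex.mem_slitPlane_iff.mpr (Or.inl (kernel_re_pos _ _))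
  · exact (continuous_kernel.comp ((UpperHalfPlane.continuous_coe.comp hf).prodMk
      (UpperHalfPlane.continuous_coe.comp hg))).continuousAt

/-! ### The rotation of a class of paths -/

/-- The direction of the derivative at `y`. -/
def direction (y : ℍ) : C(PSL(2, ℝ), Circle) where
  toFun g := ⟨derivFactor g y / ‖derivFactor g y‖, by
    have := norm_ne_zero_iff.mpr (derivFactor_ne_zero g y)
    change _ ∈ Metric.sphere (0 : ℂ) 1
    rw [mem_sphere_zero_iff_norm, norm_div, Complex.norm_real, norm_norm, div_self this]⟩
  continuous_toFun := by
    refine Continuous.subtype_mk ?_ _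
    refine (continuous_derivFactor y).div ?_ fun g => ?_
    · exact Complex.continuous_ofReal.comp (continuous_derivFactor y).norm
    · exact_mod_cast norm_ne_zero_iff.mpr (derivFactor_ne_zero g y)

theorem direction_one (y : ℍ) : direction y 1 = 1 := by
  apply Subtype.ext
  change derivFactor 1 y / ‖derivFactor 1 y‖ = 1
  simp [derivFactor_one]

theorem direction_path_zero (c : BasedPaths PSL(2, ℝ)) (y : ℍ) :
    ((direction y).comp (c : C(I, PSL(2, ℝ)))) 0 = Circle.exp 0 := by
  have : (c : C(I, PSL(2, ℝ))) 0 = 1 := c.2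
  simp [this, direction_one]

/-- The continuous angle, starting at `0`, of the derivative at `y` along a based path. -/
def anglePath (c : BasedPaths PSL(2, ℝ)) (y : ℍ) : C(I, ℝ) :=
  Circle.isCoveringMap_exp.liftPath _ 0 (direction_path_zero c y)

theorem anglePath_zero (c : BasedPaths PSL(2, ℝ)) (y : ℍ) : anglePath c y 0 = 0 :=
  Circle.isCoveringMap_exp.liftPath_zero _ 0 (direction_path_zero c y)

theorem derivFactor_eq_anglePath (c : BasedPaths PSL(2, ℝ)) (y : ℍ) (t : I) :
    derivFactor ((c : C(I, PSL(2, ℝ))) t) y =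
      ‖derivFactor ((c : C(I, PSL(2, ℝ))) t) y‖ * Complex.exp (Complex.I * (anglePath c y t : ℝ)) := by
  have h := congrFun (Circle.isCoveringMap_exp.liftPath_lifts _ 0 (direction_path_zero c y)) t
  have h' := congrArg (Subtype.val) h
  change ((Circle.exp (anglePath c y t) : Circle) : ℂ) = _ / _ at h'
  rw [Circle.coe_exp] at h'
  rw [mul_comm Complex.I, h', mul_div_cancel₀]
  exact_mod_cast norm_ne_zero_iff.mpr (derivFactor_ne_zero _ y)

/-- The total rotation of the derivative at `y` along any path in the class `a`. -/
def rot (a : UniversalCover PSL(2, ℝ)) (y : ℍ) : ℝ :=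
  Quotient.liftOn a (fun c => anglePath c y 1) fun c c' h => by
    have h' : (c : C(I, PSL(2, ℝ))).HomotopicRel (c' : C(I, PSL(2, ℝ))) {0, 1} := h
    exact Circle.isCoveringMap_exp.liftPath_apply_one_eq_of_homotopicRel
      (ContinuousMap.HomotopicRel.comp_continuousMap h' (direction y)) 0 _ _

theorem rot_mk (c : BasedPaths PSL(2, ℝ)) (y : ℍ) :
    rot (UniversalCover.mk c) y = anglePath c y 1 := rfl

theorem exp_I_mul_eq_of_pos_smul {k : ℂ} {r s α β : ℝ} (hr : 0 < r) (hs : 0 < s)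
    (h : (r : ℂ) * Complex.exp (Complex.I * α) = s * k * Complex.exp (Complex.I * β)) :
    Complex.exp ((α - β : ℝ) * Complex.I) = k / ‖k‖ := by
  have hn := congrArg norm h
  rw [norm_mul, norm_mul, norm_mul, mul_comm Complex.I, mul_comm Complex.I,
    Complex.norm_exp_ofReal_mul_I, Complex.norm_exp_ofReal_mul_I, Complex.norm_real,
    Complex.norm_real, Real.norm_of_nonneg hr.le, Real.norm_of_nonneg hs.le, mul_one, mul_one] at hn
  have hk : ‖k‖ ≠ 0 := fun h0 => by
    rw [h0, mul_zero] at hn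
    exact hr.ne' hn
  have hkc : ((‖k‖ : ℝ) : ℂ) ≠ 0 := by exact_mod_cast hk
  have hsc : (s : ℂ) ≠ 0 := by exact_mod_cast hs.ne'
  rw [Complex.ofReal_sub, sub_mul, Complex.exp_sub, div_eq_div_iff (Complex.exp_ne_zero _) hkc]
  rw [hn, mul_comm Complex.I, mul_comm Complex.I] at h
  push_cast at h
  apply mul_left_cancel₀ hsc
  linear_combination h

/-- Any continuous angle may compute the rotation, measured from an arbitrary fixed direction `k`:
its difference from the lifted angle has constant exponential, hence is constant by uniqueness of
lifts. -/
theorem rot_mk_eq (c : BasedPaths PSL(2, ℝ)) (y : ℍ) (θ : C(I, ℝ)) (k : ℂ)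
    (h : ∀ t, ∃ r : ℝ, 0 < r ∧ derivFactor ((c : C(I, PSL(2, ℝ))) t) y =
      r * k * Complex.exp (Complex.I * (θ t : ℝ))) :
    rot (UniversalCover.mk c) y = θ 1 - θ 0 := by
  have hexp : ∀ t, Complex.exp ((anglePath c y t - θ t : ℝ) * Complex.I) = k / ‖k‖ := by
    intro t
    obtain ⟨r, hr, h'⟩ := h t
    rw [derivFactor_eq_anglePath] at h'
    exact exp_I_mul_eq_of_pos_smul (norm_pos_iff.mpr (derivFactor_ne_zero _ y)) hr h'
  have hconst := Circle.isCoveringMap_exp.eq_of_comp_eq (A := I)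
    (g₁ := fun t => anglePath c y t - θ t)
    (g₂ := fun _ => anglePath c y 0 - θ 0) (by fun_prop) (by fun_prop)
    (by
      funext t
      apply Subtype.ext
      simp only [Function.comp]
      rw [Circle.coe_exp, Circle.coe_exp, hexp, hexp]) 0 rfl
  have h1 := congrFun hconst 1
  rw [anglePath_zero] at h1
  rw [rot_mk]
  linarith

/-- The kernel identity, solved for the derivative at `z` in terms of the one at `y`. The conjugate
on the latter turns `-α` into `+α` after division. -/
theorem derivFactor_eq_mul_halfAngle (g : PSL(2, ℝ)) (y z : ℍ) {r α : ℝ} (hr : 0 < r)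
    (h : derivFactor g y = r * Complex.exp (Complex.I * α)) :
    ∃ s : ℝ, 0 < s ∧ derivFactor g z = s * Complex.exp (Complex.I *
      (α + 2 * halfAngle (g • z : ℍ) (g • y : ℍ) - 2 * halfAngle z y : ℝ)) := by
  have hk := kernel_smul_sq g z y
  rw [kernel_sq_eq, kernel_sq_eq, h] at hk
  have h1 : 0 < ‖kernel z y‖ := norm_pos_iff.mpr (kernel_ne_zero z y)
  have h2 : 0 < ‖kernel (g • z : ℍ) (g • y : ℍ)‖ := norm_pos_iff.mpr (kernel_ne_zero _ _)
  refine ⟨‖kernel (g • z : ℍ) (g • y : ℍ)‖ ^ 2 / ‖kernel z y‖ ^ 2 / r, by positivity, ?_⟩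
  have e : (starRingEnd ℂ) (Complex.exp (Complex.I * α)) = Complex.exp (-(Complex.I * α)) := by
    rw [← Complex.exp_conj]; simp
  rw [map_mul, Complex.conj_ofReal, e] at hk
  have e2 : Complex.I * (α + 2 * halfAngle (g • z : ℍ) (g • y : ℍ) - 2 * halfAngle z y : ℝ) =
      Complex.I * (2 * halfAngle (g • z : ℍ) (g • y : ℍ) : ℝ) + Complex.I * α -
        Complex.I * (2 * halfAngle z y : ℝ) := by
    push_cast; ring
  rw [e2, Complex.exp_sub, Complex.exp_add]
  have h1' : ((‖kernel z y‖ : ℝ) : ℂ) ≠ 0 := by exact_mod_cast h1.ne'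
  have hr' : (r : ℂ) ≠ 0 := by exact_mod_cast hr.ne'
  have h3 := Complex.exp_ne_zero (Complex.I * (2 * halfAngle z y : ℝ))
  have h4 := Complex.exp_ne_zero (Complex.I * α)
  rw [Complex.exp_neg] at hk
  push_cast at hk h3 ⊢
  field_simp at hk ⊢
  linear_combination -hk

theorem mk_surjective (a : UniversalCover PSL(2, ℝ)) : ∃ c, UniversalCover.mk c = a :=
  Quotient.exists_rep a

theorem proj_mk (c : BasedPaths PSL(2, ℝ)) :
    UniversalCover.proj (UniversalCover.mk c) = (c : C(I, PSL(2, ℝ))) 1 := rfl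

/-- By the chain rule the derivative of the product path is that of the first path at a moving
point, times that of the second at `y`. The kernel identity brings the moving point back to `y`, at
the cost of the half-angle terms. -/
theorem rot_mul (a b : UniversalCover PSL(2, ℝ)) (y : ℍ) :
    rot (a * b) y = rot b y + rot a y +
      2 * halfAngle ((a.proj * b.proj) • y : ℍ) (a.proj • y : ℍ) - 2 * halfAngle (b.proj • y : ℍ) y := by
  obtain ⟨c, rfl⟩ := mk_surjective a
  obtain ⟨c', rfl⟩ := mk_surjective b
  have hc : Continuous fun t : I => (c : C(I, PSL(2, ℝ))) t := map_continuous _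
  have hc' : Continuous fun t : I => (c' : C(I, PSL(2, ℝ))) t := map_continuous _
  set θ : C(I, ℝ) := ⟨fun t => anglePath c' y t + (anglePath c y t +
    2 * halfAngle (((c : C(I, PSL(2, ℝ))) t * (c' : C(I, PSL(2, ℝ))) t) • y : ℍ)
      ((c : C(I, PSL(2, ℝ))) t • y : ℍ) - 2 * halfAngle ((c' : C(I, PSL(2, ℝ))) t • y : ℍ) y), by
    have h1 := Continuous.halfAngle ((continuous_smul_const y).comp (hc.mul hc'))
      ((continuous_smul_const y).comp hc)
    have h2 := Continuous.halfAngle ((continuous_smul_const y).comp hc') (continuous_const (y := y))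
    have h3 := (anglePath c y).continuous
    have h4 := (anglePath c' y).continuous
    simp only [Function.comp_def] at h1 h2
    exact h4.add ((h3.add (h1.const_mul 2)).sub (h2.const_mul 2))⟩ with hθ
  have key := rot_mk_eq (c * c') y θ 1 (by
    intro t
    obtain ⟨s, hs, h⟩ := derivFactor_eq_mul_halfAngle ((c : C(I, PSL(2, ℝ))) t) y
      ((c' : C(I, PSL(2, ℝ))) t • y) (norm_pos_iff.mpr (derivFactor_ne_zero _ y))
      (derivFactor_eq_anglePath c y t)
    refine ⟨s * ‖derivFactor ((c' : C(I, PSL(2, ℝ))) t) y‖,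
      mul_pos hs (norm_pos_iff.mpr (derivFactor_ne_zero _ y)), ?_⟩
    change derivFactor ((c : C(I, PSL(2, ℝ))) t * (c' : C(I, PSL(2, ℝ))) t) y = _
    rw [derivFactor_mul, h]
    conv_lhs => rw [derivFactor_eq_anglePath c' y t]
    rw [hθ]
    simp only [ContinuousMap.coe_mk, ← mul_smul]
    rw [Complex.ofReal_add (anglePath c' y t), mul_add, Complex.exp_add, Complex.ofReal_mul s]
    ring)
  have e0 : (c : C(I, PSL(2, ℝ))) 0 = 1 := c.2
  have e0' : (c' : C(I, PSL(2, ℝ))) 0 = 1 := c'.2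
  have e : θ 0 = 0 := by
    simp [hθ, anglePath_zero, e0, e0', halfAngle_self]
  change rot (UniversalCover.mk (c * c')) y = _
  rw [key, e, proj_mk, proj_mk, rot_mk, rot_mk, hθ]
  simp only [ContinuousMap.coe_mk]
  ring

theorem rot_change (a : UniversalCover PSL(2, ℝ)) (y z : ℍ) :
    rot a z = rot a y + 2 * halfAngle (a.proj • z : ℍ) (a.proj • y : ℍ) - 2 * halfAngle z y := by
  obtain ⟨c, rfl⟩ := mk_surjective a
  have hc : Continuous fun t : I => (c : C(I, PSL(2, ℝ))) t := map_continuous _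
  set θ : C(I, ℝ) := ⟨fun t => anglePath c y t +
    2 * halfAngle ((c : C(I, PSL(2, ℝ))) t • z : ℍ)
      ((c : C(I, PSL(2, ℝ))) t • y : ℍ) - 2 * halfAngle z y, by
    have h1 := Continuous.halfAngle ((continuous_smul_const z).comp hc)
      ((continuous_smul_const y).comp hc)
    have h3 := (anglePath c y).continuous
    exact (h3.add (h1.const_mul 2)).sub continuous_const⟩ with hθ
  have key := rot_mk_eq c z θ 1 (by
    intro t
    obtain ⟨s, hs, h⟩ := derivFactor_eq_mul_halfAngle ((c : C(I, PSL(2, ℝ))) t) y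
      z (norm_pos_iff.mpr (derivFactor_ne_zero _ y)) (derivFactor_eq_anglePath c y t)
    exact ⟨s, hs, by rw [h, mul_one]; rfl⟩)
  have e0 : (c : C(I, PSL(2, ℝ))) 0 = 1 := c.2
  have e : θ 0 = 0 := by simp [hθ, anglePath_zero, e0]
  rw [key, e, proj_mk, rot_mk, hθ]
  simp only [ContinuousMap.coe_mk]
  ring

/-! ### Geodesics -/

theorem coe_axisPoint (s : ℝ) : (axisPoint s : ℂ) = Complex.I * (Real.exp s : ℂ) := rfl

theorem axisPoint_re (s : ℝ) : (axisPoint s).re = 0 := by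
  change (Complex.I * (Real.exp s : ℂ)).re = 0
  rw [Complex.I_mul_re, Complex.ofReal_im, neg_zero]

theorem axisPoint_im (s : ℝ) : (axisPoint s).im = Real.exp s := by
  change (Complex.I * (Real.exp s : ℂ)).im = _
  rw [Complex.I_mul_im, Complex.ofReal_re]

theorem axisPoint_zero : axisPoint 0 = UpperHalfPlane.I := by
  apply UpperHalfPlane.ext
  simp [coe_axisPoint]

theorem halfAngle_axisPoint (s t : ℝ) : halfAngle (axisPoint s) (axisPoint t) = 0 := by
  rw [halfAngle, Complex.arg_eq_zero_iff]
  refine ⟨(kernel_re_pos _ _).le, ?_⟩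
  change (axisPoint t).re - (axisPoint s).re = 0
  rw [axisPoint_re, axisPoint_re, sub_zero]

theorem continuous_axisPoint : Continuous axisPoint := by
  refine UpperHalfPlane.isEmbedding_coe.continuous_iff.mpr ?_
  change Continuous fun s : ℝ => Complex.I * (Real.exp s : ℂ)
  fun_prop

theorem continuous_smul_plane (g : PSL(2, ℝ)) : Continuous fun z : ℍ => g • z := by
  induction g using QuotientGroup.induction_on with | H g
  refine UpperHalfPlane.isEmbedding_coe.continuous_iff.mpr ?_
  have h : (UpperHalfPlane.coe ∘ fun z : ℍ => (QuotientGroup.mk g : PSL(2, ℝ)) • z) =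
      fun z : ℍ => ((g 0 0 : ℝ) * (z : ℂ) + (g 0 1 : ℝ)) / ((g 1 0 : ℝ) * (z : ℂ) + (g 1 1 : ℝ)) :=
    funext fun z => coe_mk_smul g z
  rw [h]
  have hc := UpperHalfPlane.continuous_coe
  exact Continuous.div (by fun_prop) (by fun_prop) fun z => denom_ne g z

theorem continuous_geodesic (h : PSL(2, ℝ)) : Continuous (geodesic h) :=
  (continuous_smul_plane h).comp continuous_axisPoint

theorem geodesicTangent_def (h : PSL(2, ℝ)) (s : ℝ) :
    geodesicTangent h s = derivFactor h (axisPoint s) * (Complex.I * (Real.exp s : ℂ)) := rfl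

theorem norm_geodesicTangent (h : PSL(2, ℝ)) (s : ℝ) :
    ‖geodesicTangent h s‖ = (geodesic h s).im := by
  have := Real.exp_pos s
  rw [geodesicTangent_def, norm_mul, norm_mul, Complex.norm_I, one_mul, norm_derivFactor,
    axisPoint_im, Complex.norm_real, Real.norm_of_nonneg this.le, div_mul_cancel₀ _ this.ne']
  rfl

/-- Along the imaginary axis the tangent direction is constant and the half-angles vanish, so all
turning of the image tangent comes from the half-angle of the image points. The positive factor is
then recovered from the norms. -/
theorem geodesicTangent_eq (h : PSL(2, ℝ)) (s : ℝ) :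
    geodesicTangent h s = ((geodesic h s).im / (geodesic h 0).im : ℝ) * geodesicTangent h 0 *
      Complex.exp (Complex.I * (2 * halfAngle (geodesic h s) (geodesic h 0) : ℝ)) := by
  have h0 : derivFactor h (axisPoint 0) = (‖derivFactor h (axisPoint 0)‖ : ℝ) *
      Complex.exp (Complex.I * (Complex.arg (derivFactor h (axisPoint 0)) : ℝ)) := by
    rw [mul_comm Complex.I, Complex.norm_mul_exp_arg_mul_I]
  have hpos : 0 < ‖derivFactor h (axisPoint 0)‖ := norm_pos_iff.mpr (derivFactor_ne_zero _ _)
  obtain ⟨r, hr, hr'⟩ := derivFactor_eq_mul_halfAngle h (axisPoint 0) (axisPoint s) hpos h0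
  have key : ∃ r : ℝ, 0 < r ∧ geodesicTangent h s = r * geodesicTangent h 0 *
      Complex.exp (Complex.I * (2 * halfAngle (geodesic h s) (geodesic h 0) : ℝ)) := by
    refine ⟨r / ‖derivFactor h (axisPoint 0)‖ * Real.exp s, by positivity, ?_⟩
    rw [geodesicTangent_def, geodesicTangent_def, hr', halfAngle_axisPoint, mul_zero, sub_zero,
      Complex.ofReal_add, mul_add, Complex.exp_add]
    conv_rhs => rw [h0]
    have hne : ((‖derivFactor h (axisPoint 0)‖ : ℝ) : ℂ) ≠ 0 := by exact_mod_cast hpos.ne'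
    simp only [geodesic, Real.exp_zero, Complex.ofReal_one, Complex.ofReal_mul, Complex.ofReal_div]
    rw [← h0]
    field_simp
    linear_combination (-(r : ℂ)) * h0
  obtain ⟨ρ, hρ, e⟩ := key
  have hn := congrArg norm e
  rw [norm_mul, norm_mul, mul_comm Complex.I, Complex.norm_exp_ofReal_mul_I, mul_one,
    norm_geodesicTangent, norm_geodesicTangent, Complex.norm_real, Real.norm_of_nonneg hρ.le] at hn
  rw [e, hn, mul_div_cancel_right₀ _ (geodesic h 0).im_pos.ne']

theorem geodesic_mul_rotation_pi (h : PSL(2, ℝ)) (s : ℝ) :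
    geodesic (h * QuotientGroup.mk (rotation Real.pi)) s = geodesic h (-s) := by
  rw [geodesic, mul_smul, geodesic]
  congr 1
  apply UpperHalfPlane.ext
  rw [coe_mk_smul, coe_axisPoint, coe_axisPoint]
  have : Complex.exp (s : ℂ) ≠ 0 := Complex.exp_ne_zero _
  simp only [rotation, Matrix.SpecialLinearGroup.coe_mk, Matrix.of_apply, Matrix.cons_val', Matrix.cons_val_zero,
    Matrix.cons_val_one, Matrix.cons_val_fin_one, Real.cos_pi_div_two, Real.sin_pi_div_two]
  push_cast
  rw [Complex.exp_neg]
  field_simp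
  simp
  linear_combination Complex.exp s * Complex.I_mul_I

theorem exists_rotation_smul_re_eq_zero (w : ℍ) :
    ∃ φ : ℝ, ((QuotientGroup.mk (rotation φ) : PSL(2, ℝ)) • w).re = 0 := by
  -- Up to a positive factor, the real part of the rotated point is `cos φ * re w + sin φ * (1 -
  -- |w|²) / 2`. The unit vector at angle `φ` is chosen orthogonal to the coefficient vector `ζ`.
  set ζ : ℂ := ⟨w.re, (1 - Complex.normSq w) / 2⟩ with hζ
  set φ := Complex.arg ζ + Real.pi / 2 with hφ
  have hre : w.re = ‖ζ‖ * Real.cos (Complex.arg ζ) := (Complex.norm_mul_cos_arg ζ).symm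
  have him : (1 - Complex.normSq w) / 2 = ‖ζ‖ * Real.sin (Complex.arg ζ) :=
    (Complex.norm_mul_sin_arg ζ).symm
  have h1 : Real.cos φ = -Real.sin (Complex.arg ζ) := Real.cos_add_pi_div_two _
  have h2 : Real.sin φ = Real.cos (Complex.arg ζ) := Real.sin_add_pi_div_two _
  have hzero : Real.sin φ * ((1 - Complex.normSq w) / 2) + Real.cos φ * w.re = 0 := by
    rw [h1, h2, him, hre]; ring
  refine ⟨φ, ?_⟩
  change ((((QuotientGroup.mk (rotation φ) : PSL(2, ℝ)) • w : ℍ) : ℂ)).re = 0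
  rw [coe_mk_smul, Complex.div_re, ← add_div]
  have e1 : Real.sin φ = 2 * Real.sin (φ / 2) * Real.cos (φ / 2) := by
    rw [← Real.sin_two_mul]; congr 1; ring
  have e2 : Real.cos φ = Real.cos (φ / 2) ^ 2 - Real.sin (φ / 2) ^ 2 := by
    rw [← Real.cos_two_mul']; congr 1; ring
  rw [e1, e2, Complex.normSq_apply] at hzero
  rw [div_eq_zero_iff]
  left
  simp only [rotation, Matrix.SpecialLinearGroup.coe_mk, Matrix.of_apply, Matrix.cons_val', Matrix.cons_val_zero,
    Matrix.cons_val_one, Matrix.cons_val_fin_one, Complex.add_re, Complex.add_im,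
    Complex.re_ofReal_mul, Complex.im_ofReal_mul, Complex.ofReal_re, Complex.ofReal_im]
  simp only [UpperHalfPlane.coe_re, UpperHalfPlane.coe_im] at hzero ⊢
  linear_combination hzero

theorem eq_axisPoint_of_re_eq_zero {w : ℍ} (h : w.re = 0) : w = axisPoint (Real.log w.im) := by
  apply UpperHalfPlane.ext
  rw [coe_axisPoint, Real.exp_log w.im_pos]
  apply Complex.ext
  · simpa using h
  · simp

/-- Move `y` to `i`, then rotate about `i` until `w` lies on the imaginary axis. If the parameter
comes out negative, a half-turn reverses the geodesic. -/
theorem exists_geodesic (y w : ℍ) :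
    ∃ (h : PSL(2, ℝ)) (d : ℝ), 0 ≤ d ∧ geodesic h 0 = y ∧ geodesic h d = w := by
  have key : ∃ (h : PSL(2, ℝ)) (d : ℝ), geodesic h 0 = y ∧ geodesic h d = w := by
    set k : PSL(2, ℝ) := QuotientGroup.mk y.toSL2R with hk
    have hkI : k • UpperHalfPlane.I = y := toSL2R_smul_I y
    obtain ⟨φ, hφ⟩ := exists_rotation_smul_re_eq_zero (k⁻¹ • w)
    set r : PSL(2, ℝ) := QuotientGroup.mk (rotation φ) with hr
    have hrI : r • UpperHalfPlane.I = UpperHalfPlane.I := rotation_smul_I φ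
    refine ⟨k * r⁻¹, Real.log (r • k⁻¹ • w).im, ?_, ?_⟩
    · rw [geodesic, axisPoint_zero, mul_smul, inv_smul_eq_iff.mpr hrI.symm, hkI]
    · rw [geodesic, ← eq_axisPoint_of_re_eq_zero hφ, mul_smul, inv_smul_smul, smul_inv_smul]
  obtain ⟨h, d, h0, hd⟩ := key
  rcases le_total 0 d with hd0 | hd0
  · exact ⟨h, d, hd0, h0, hd⟩
  · refine ⟨h * QuotientGroup.mk (rotation Real.pi), -d, neg_nonneg.mpr hd0, ?_, ?_⟩
    · rw [geodesic_mul_rotation_pi, neg_zero, h0]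
    · rw [geodesic_mul_rotation_pi, neg_neg, hd]

/-! ### Existence and uniqueness of the twist in the plane -/

/-- The angle from the tangent to the field, plus the turning of the tangent itself, is a continuous
angle for the derivative up to the constant direction `geodesicTangent k 0 / u`. This makes the
twist unique. -/
theorem eq_of_isTwistAt {a : UniversalCover PSL(2, ℝ)} {y : ℍ} {T : ℝ} (h : IsTwistAt a y T) :
    T = rot a y - 2 * halfAngle (a.proj • y : ℍ) y := by
  obtain ⟨c, k, d, u, θ, rfl, hd, hu, hgeo, hV, rfl⟩ := h
  have hc0 : (c : C(I, PSL(2, ℝ))) 0 = 1 := c.2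
  have h0 : geodesic k 0 = y := by
    have := hgeo 0
    rw [hc0, one_smul] at this
    simpa using this.symm
  have hu0 : u ≠ 0 := norm_pos_iff.mp (hu ▸ y.im_pos)
  have hc : Continuous fun t : I => (c : C(I, PSL(2, ℝ))) t := map_continuous _
  set ψ : C(I, ℝ) := ⟨fun t => θ t + 2 * halfAngle ((c : C(I, PSL(2, ℝ))) t • y : ℍ) y, by
    have h1 := Continuous.halfAngle ((continuous_smul_const y).comp hc) (continuous_const (y := y))
    exact (map_continuous θ).add (h1.const_mul 2)⟩ with hψ
  have key := rot_mk_eq c y ψ (geodesicTangent k 0 / u) (by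
    intro t
    refine ⟨(geodesic k (d * t)).im / (geodesic k 0).im,
      div_pos (UpperHalfPlane.im_pos _) (UpperHalfPlane.im_pos _), ?_⟩
    have := hV t
    rw [differential_eq, geodesicTangent_eq, h0, ← hgeo t] at this
    rw [h0, ← hgeo t, hψ]
    simp only [ContinuousMap.coe_mk]
    rw [Complex.ofReal_add (θ t), mul_add, Complex.exp_add]
    apply mul_right_cancel₀ hu0
    rw [this]
    field_simp)
  rw [key, hψ, proj_mk]
  simp only [ContinuousMap.coe_mk, hc0, one_smul, halfAngle_self]
  ring

/-! ### Straight-line homotopies in frame coordinates, and existence of the twist. -/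

theorem frame_self_zero (y : ℍ) : frame y y 0 = 1 := by
  refine eq_of_smul_eq_of_derivFactor_eq _ _ y ?_ ?_
  · rw [frame_smul, one_smul]
  · rw [derivFactor_frame, derivFactor_one, div_self y.im_pos.ne']
    simp

/-- The point dividing the Euclidean segment from `z` to `w` in the ratio `s : 1 - s`. -/
def segmentPoint (s : I) (z w : ℍ) : ℍ :=
  ⟨(1 - (s : ℝ) : ℝ) * (z : ℂ) + ((s : ℝ) : ℂ) * w, by
    rw [Complex.add_im, Complex.im_ofReal_mul, Complex.im_ofReal_mul]
    have h1 := z.im_pos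
    have h2 := w.im_pos
    have h3 := s.2.1
    have h4 := s.2.2
    rcases h3.eq_or_lt with h | h
    · rw [← h]; simpa using h1
    · have : 0 < (s : ℝ) * (w : ℂ).im := mul_pos h h2
      have : 0 ≤ (1 - (s : ℝ)) * (z : ℂ).im := mul_nonneg (by linarith) h1.le
      linarith⟩

theorem segmentPoint_zero (z w : ℍ) : segmentPoint 0 z w = z := by
  apply UpperHalfPlane.ext
  simp [segmentPoint]

theorem segmentPoint_one (z w : ℍ) : segmentPoint 1 z w = w := by
  apply UpperHalfPlane.ext
  simp [segmentPoint]

theorem segmentPoint_self (s : I) (z : ℍ) : segmentPoint s z z = z := by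
  apply UpperHalfPlane.ext
  simp [segmentPoint]
  ring

theorem Continuous.segmentPoint {X : Type*} [TopologicalSpace X] {s : X → I} {f g : X → ℍ}
    (hs : Continuous s) (hf : Continuous f) (hg : Continuous g) :
    Continuous fun x => segmentPoint (s x) (f x) (g x) := by
  refine UpperHalfPlane.isEmbedding_coe.continuous_iff.mpr ?_
  change Continuous fun x => (1 - (s x : ℝ) : ℝ) * (f x : ℂ) + ((s x : ℝ) : ℂ) * (g x : ℂ)
  have h1 := UpperHalfPlane.continuous_coe.comp hf
  have h2 := UpperHalfPlane.continuous_coe.comp hg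
  simp only [Function.comp_def] at h1 h2
  have h3 : Continuous fun x => (s x : ℝ) := continuous_subtype_val.comp hs
  fun_prop

/-- The path of isometries whose frames at `y` have base points `w t` and directions `φ t`. -/
def framePath (y : ℍ) (w : C(I, ℍ)) (φ : C(I, ℝ)) : C(I, PSL(2, ℝ)) :=
  (⟨fun p => frame y p.1 p.2, continuous_frame y⟩ : C(ℍ × ℝ, PSL(2, ℝ))).comp (w.prodMk φ)

theorem framePath_zero (y : ℍ) (w : C(I, ℍ)) (φ : C(I, ℝ)) (hw : w 0 = y) (hφ : φ 0 = 0) :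
    framePath y w φ 0 = 1 := by
  change frame y (w 0) (φ 0) = 1
  rw [hw, hφ, frame_self_zero]

/-- The coordinates (base point, angle) range over the convex set `ℍ × ℝ`, so linear interpolation
is a homotopy, and it is stationary wherever the coordinates agree. -/
theorem framePath_homotopicRel (y : ℍ) (w w' : C(I, ℍ)) (φ φ' : C(I, ℝ))
    (h0 : w 0 = w' 0) (h1 : w 1 = w' 1) (h0' : φ 0 = φ' 0) (h1' : φ 1 = φ' 1) :
    (framePath y w φ).HomotopicRel (framePath y w' φ') {0, 1} := by
  have e1 : Continuous fun p : I × I => segmentPoint p.1 (w p.2) (w' p.2) :=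
    Continuous.segmentPoint continuous_fst (w.continuous.comp continuous_snd)
      (w'.continuous.comp continuous_snd)
  have e2 : Continuous fun p : I × I => (1 - (p.1 : ℝ)) * φ p.2 + p.1 * φ' p.2 := by fun_prop
  have e3 := Continuous.comp (g := fun p : ℍ × ℝ => frame y p.1 p.2) (f := fun p : I × I =>
    (segmentPoint p.1 (w p.2) (w' p.2), (1 - (p.1 : ℝ)) * φ p.2 + p.1 * φ' p.2))
    (continuous_frame y) (e1.prodMk e2)
  refine ⟨⟨⟨⟨fun p => frame y (segmentPoint p.1 (w p.2) (w' p.2))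
    ((1 - (p.1 : ℝ)) * φ p.2 + p.1 * φ' p.2), e3⟩,
    fun t => ?_, fun t => ?_⟩, ?_⟩⟩
  · change frame y (segmentPoint 0 (w t) (w' t)) ((1 - ((0 : I) : ℝ)) * φ t + ((0 : I) : ℝ) * φ' t) =
      frame y (w t) (φ t)
    rw [segmentPoint_zero]
    simp
  · change frame y (segmentPoint 1 (w t) (w' t)) ((1 - ((1 : I) : ℝ)) * φ t + ((1 : I) : ℝ) * φ' t) =
      frame y (w' t) (φ' t)
    rw [segmentPoint_one]
    simp
  · intro s t ht
    change frame y (segmentPoint s (w t) (w' t)) ((1 - (s : ℝ)) * φ t + (s : ℝ) * φ' t) =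
      frame y (w t) (φ t)
    have hw : w' t = w t := by rcases ht with rfl | rfl <;> simp [h0, h1]
    have hφ : φ' t = φ t := by rcases ht with rfl | rfl <;> simp [h0', h1']
    rw [hw, hφ, segmentPoint_self]
    congr 1
    ring

theorem isTwistAt_rot_sub (a : UniversalCover PSL(2, ℝ)) (y : ℍ) :
    IsTwistAt a y (rot a y - 2 * halfAngle (a.proj • y : ℍ) y) := by
  obtain ⟨c₀, rfl⟩ := mk_surjective a
  obtain ⟨h, d, hd, h0, h1⟩ := exists_geodesic y ((c₀ : C(I, PSL(2, ℝ))) 1 • y)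
  have hc₀0 : (c₀ : C(I, PSL(2, ℝ))) 0 = 1 := c₀.2
  obtain ⟨w₀, hw₀⟩ : ∃ w₀ : C(I, ℍ), ∀ t, w₀ t = (c₀ : C(I, PSL(2, ℝ))) t • y :=
    ⟨⟨fun t => (c₀ : C(I, PSL(2, ℝ))) t • y,
      (continuous_smul_const y).comp (map_continuous _)⟩, fun t => rfl⟩
  obtain ⟨w, hw⟩ : ∃ w : C(I, ℍ), ∀ t, w t = geodesic h (d * (t : ℝ)) :=
    ⟨⟨fun t => geodesic h (d * (t : ℝ)), (continuous_geodesic h).comp (by fun_prop)⟩, fun t => rfl⟩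
  -- The given path is replaced by one whose base point follows the geodesic and whose angle grows
  -- linearly to the same total rotation `R`. Equal endpoint coordinates keep it in the same class.
  obtain ⟨R, hR⟩ : ∃ R, R = anglePath c₀ y 1 := ⟨_, rfl⟩
  obtain ⟨φ, hφ⟩ : ∃ φ : C(I, ℝ), ∀ t, φ t = t * R :=
    ⟨⟨fun t => t * R, by fun_prop⟩, fun t => rfl⟩
  have hw0 : w 0 = y := by rw [hw, Set.Icc.coe_zero, mul_zero, h0]
  have hw1 : w 1 = w₀ 1 := by rw [hw, Set.Icc.coe_one, mul_one, h1, hw₀]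
  have hφ0 : φ 0 = 0 := by rw [hφ, Set.Icc.coe_zero, zero_mul]
  have hφ1 : φ 1 = R := by rw [hφ, Set.Icc.coe_one, one_mul]
  have hframe₀ : (c₀ : C(I, PSL(2, ℝ))) = framePath y w₀ (anglePath c₀ y) := by
    ext1 t
    change _ = frame y (w₀ t) (anglePath c₀ y t)
    rw [hw₀]
    exact eq_frame _ _ _ (derivFactor_eq_anglePath c₀ y t)
  have hclass : UniversalCover.mk ⟨framePath y w φ, framePath_zero y w φ hw0 hφ0⟩ =
      UniversalCover.mk c₀ := by
    symm
    refine Quotient.sound ?_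
    change (c₀ : C(I, PSL(2, ℝ))).HomotopicRel (framePath y w φ) {0, 1}
    rw [hframe₀]
    refine framePath_homotopicRel y _ _ _ _ ?_ hw1.symm ?_ ?_
    · rw [hw0, hw₀, hc₀0, one_smul]
    · rw [anglePath_zero, hφ0]
    · rw [hφ1, hR]
  have hct : ∀ t : I, framePath y w φ t = frame y (geodesic h (d * t)) (t * R) := fun t => by
    rw [← hw, ← hφ]
    rfl
  have hθ : Continuous fun t : I => t * R - 2 * halfAngle (geodesic h (d * t)) y := by
    have e1 := Continuous.halfAngle w.continuous (continuous_const (y := y))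
    simp only [hw] at e1
    have e2 : Continuous fun t : I => (t : ℝ) * R := by fun_prop
    exact e2.sub (e1.const_mul 2)
  refine ⟨⟨framePath y w φ, framePath_zero y w φ hw0 hφ0⟩, h, d, geodesicTangent h 0, ⟨_, hθ⟩,
    hclass, hd, ?_, ?_, ?_, ?_⟩
  · rw [norm_geodesicTangent, h0]
  · intro t
    change framePath y w φ t • y = _
    rw [hct, frame_smul]
  · intro t
    change differential (framePath y w φ t) y _ = _
    rw [hct, differential_eq, derivFactor_frame, geodesicTangent_eq h (d * t), h0]
    simp only [ContinuousMap.coe_mk]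
    rw [Complex.ofReal_sub, mul_sub, Complex.exp_sub]
    have := Complex.exp_ne_zero (Complex.I * (2 * halfAngle (geodesic h (d * (t : ℝ))) y : ℝ))
    field_simp
  · simp only [ContinuousMap.coe_mk, Set.Icc.coe_one, Set.Icc.coe_zero, mul_one, one_mul,
      mul_zero, zero_mul, h0, h1, halfAngle_self, proj_mk, rot_mk, ← hR]
    ring

theorem twistInterior_eq (a : UniversalCover PSL(2, ℝ)) (y : ℍ) :
    twistInterior a y = rot a y - 2 * halfAngle (a.proj • y : ℍ) y :=
  eq_of_isTwistAt (Classical.epsilon_spec ⟨_, isTwistAt_rot_sub a y⟩)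

/-- Twice the argument of the product of the kernels along the sides of a triangle. -/
def triangleAngle (x y z : ℂ) : ℝ := 2 * (halfAngle x y + halfAngle y z + halfAngle z x)

theorem twistInterior_mul (a b : UniversalCover PSL(2, ℝ)) (y : ℍ) :
    twistInterior (a * b) y = twistInterior a y + twistInterior b y -
      triangleAngle y (a.proj • y : ℍ) ((a.proj * b.proj) • y : ℍ) := by
  rw [twistInterior_eq, twistInterior_eq, twistInterior_eq, rot_mul, map_mul, triangleAngle]
  have h1 := halfAngle_swap (a.proj • y) ((a.proj * b.proj) • y)
  have h2 := halfAngle_swap (a.proj • y) y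
  linarith

/-- The difference is the holonomy around the quadrilateral `x`, `αx`, `αy`, `y`, cut along the
diagonal from `x` to `αy`. This form has a visible limit as `x` goes to infinity with `y` fixed. -/
theorem twistInterior_change (a : UniversalCover PSL(2, ℝ)) (x y : ℍ) :
    twistInterior a x = twistInterior a y + triangleAngle x (a.proj • x : ℍ) (a.proj • y : ℍ) +
      triangleAngle y x (a.proj • y : ℍ) := by
  rw [twistInterior_eq, twistInterior_eq, rot_change a y x, triangleAngle, triangleAngle]
  have h1 := halfAngle_swap (a.proj • x) x
  have h2 := halfAngle_swap (a.proj • y) x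
  have h3 := halfAngle_swap x y
  linarith

/-! ### The area below which a vertical strip is cut off by a half-circle -/

theorem lintegral_Ioi_one_div_sq {s : ℝ} (hs : 0 < s) :
    ∫⁻ t in Set.Ioi s, ENNReal.ofReal (1 / t ^ 2) = ENNReal.ofReal (1 / s) := by
  have h1 : IntegrableOn (fun t : ℝ => t ^ (-2 : ℝ)) (Set.Ioi s) :=
    integrableOn_Ioi_rpow_of_lt (by norm_num) hs
  have h2 := integral_Ioi_rpow_of_lt (a := -2) (by norm_num) hs
  have h3 : ∀ t ∈ Set.Ioi s, t ^ (-2 : ℝ) = 1 / t ^ 2 := fun t ht => by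
    have : 0 < t := hs.trans ht
    rw [Real.rpow_neg this.le, one_div]
    norm_num
  rw [setLIntegral_congr_fun measurableSet_Ioi (fun t ht => by rw [← h3 t ht]),
    ← ofReal_integral_eq_lintegral_ofReal h1, h2]
  · congr 1
    norm_num
    rw [Real.rpow_neg_one]
  · filter_upwards [ae_restrict_mem measurableSet_Ioi] with t ht
    exact Real.rpow_nonneg (hs.trans ht).le _

theorem volume_eq_lintegral_real_prod (S : Set (ℝ × ℝ)) (hS : MeasurableSet S)
    (hpos : ∀ p ∈ S, 0 < p.2) :
    volume {z : ℍ | (z.re, z.im) ∈ S} = ∫⁻ p in S, ENNReal.ofReal (1 / p.2 ^ 2) := by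
  have himg : UpperHalfPlane.coe '' {z : ℍ | (z.re, z.im) ∈ S} =
      Complex.measurableEquivRealProd ⁻¹' S := by
    ext ζ
    constructor
    · rintro ⟨z, hz, rfl⟩
      exact hz
    · intro hζ
      exact ⟨⟨ζ, hpos _ hζ⟩, hζ, rfl⟩
  rw [UpperHalfPlane.volume_eq_lintegral, himg,
    ← Complex.volume_preserving_equiv_real_prod.setLIntegral_comp_preimage hS (by fun_prop)]
  refine setLIntegral_congr_fun (Complex.measurableEquivRealProd.measurable hS) fun ζ hζ => ?_
  have h : 0 < ζ.im := hpos _ hζ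
  have e : (1 / ζ.im ^ 2 : ℝ) = (((1 / ‖ζ.im‖₊) ^ 2 : NNReal) : ℝ) := by
    push_cast
    rw [Real.norm_of_nonneg h.le]
    ring
  change _ = ENNReal.ofReal (1 / ζ.im ^ 2)
  rw [e, ENNReal.ofReal_coe_nnreal]

/-- Fubini: the vertical integral of `1 / t²` above height `f x` is `1 / f x`. -/
theorem volume_region_eq_lintegral {x₁ x₂ : ℝ} {f : ℝ → ℝ} (hf : Measurable f)
    (hpos : ∀ x ∈ Set.Ioo x₁ x₂, 0 < f x) :
    volume {z : ℍ | z.re ∈ Set.Ioo x₁ x₂ ∧ f z.re < z.im} =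
      ∫⁻ x in Set.Ioo x₁ x₂, ENNReal.ofReal (1 / f x) := by
  set S : Set (ℝ × ℝ) := {p | p.1 ∈ Set.Ioo x₁ x₂ ∧ f p.1 < p.2} with hS
  have hmeas : MeasurableSet S :=
    (measurable_fst measurableSet_Ioo).inter (measurableSet_lt (hf.comp measurable_fst) measurable_snd)
  have hm : Measurable fun p : ℝ × ℝ => ENNReal.ofReal (1 / p.2 ^ 2) := by fun_prop
  rw [show {z : ℍ | z.re ∈ Set.Ioo x₁ x₂ ∧ f z.re < z.im} = {z : ℍ | (z.re, z.im) ∈ S} from rfl,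
    volume_eq_lintegral_real_prod S hmeas fun p hp => (hpos _ hp.1).trans hp.2,
    ← lintegral_indicator hmeas, Measure.volume_eq_prod,
    lintegral_prod _ (hm.indicator hmeas).aemeasurable, ← lintegral_indicator measurableSet_Ioo]
  congr 1
  funext x
  by_cases hx : x ∈ Set.Ioo x₁ x₂
  · rw [Set.indicator_of_mem hx, ← lintegral_Ioi_one_div_sq (hpos x hx),
      ← lintegral_indicator measurableSet_Ioi]
    congr 1
    funext y
    by_cases hy : f x < y
    · rw [Set.indicator_of_mem (show (x, y) ∈ S from ⟨hx, hy⟩), Set.indicator_of_mem (show y ∈ Set.Ioi (f x) from hy)]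
    · rw [Set.indicator_of_notMem (fun h : (x, y) ∈ S => hy h.2), Set.indicator_of_notMem (show y ∉ Set.Ioi (f x) from hy)]
  · rw [Set.indicator_of_notMem hx]
    have : ∀ y, S.indicator (fun p : ℝ × ℝ => ENNReal.ofReal (1 / p.2 ^ 2)) (x, y) = 0 := fun y =>
      Set.indicator_of_notMem (fun h : (x, y) ∈ S => hx h.1) _
    rw [lintegral_congr this, lintegral_zero]

theorem lintegral_one_div_sqrt {x₁ x₂ c r : ℝ} (hr : 0 < r) (hx : x₁ ≤ x₂)
    (hpos : ∀ x ∈ Set.Ioo x₁ x₂, 0 < r ^ 2 - (x - c) ^ 2) :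
    ∫⁻ x in Set.Ioo x₁ x₂, ENNReal.ofReal (1 / √(r ^ 2 - (x - c) ^ 2)) =
      ENNReal.ofReal (Real.arcsin ((x₂ - c) / r) - Real.arcsin ((x₁ - c) / r)) := by
  have hcont : ContinuousOn (fun x => Real.arcsin ((x - c) / r)) (Set.Icc x₁ x₂) := by
    refine Continuous.continuousOn (Real.continuous_arcsin.comp ?_)
    fun_prop
  have hder : ∀ x ∈ Set.Ioo x₁ x₂,
      HasDerivAt (fun x => Real.arcsin ((x - c) / r)) (1 / √(r ^ 2 - (x - c) ^ 2)) x := by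
    intro x hx
    have h := hpos x hx
    have hu : ((x - c) / r) ^ 2 < 1 := by
      rw [div_pow, div_lt_one (by positivity)]
      linarith
    have h1 : (x - c) / r ≠ -1 := fun h => by rw [h] at hu; norm_num at hu
    have h2 : (x - c) / r ≠ 1 := fun h => by rw [h] at hu; norm_num at hu
    have hd : HasDerivAt (fun x => (x - c) / r) (1 / r) x := ((hasDerivAt_id x).sub_const c).div_const r
    convert! (Real.hasDerivAt_arcsin h1 h2).comp x hd using 1
    rw [show r ^ 2 - (x - c) ^ 2 = r ^ 2 * (1 - ((x - c) / r) ^ 2) by field_simp,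
      Real.sqrt_mul (by positivity), Real.sqrt_sq hr.le]
    field_simp
  have hnn : ∀ x ∈ Set.Ioo x₁ x₂, 0 ≤ 1 / √(r ^ 2 - (x - c) ^ 2) := fun x _ => by positivity
  -- The integrand blows up at an end that is an ideal vertex; integrability follows because it is
  -- the nonnegative derivative of a function continuous up to the ends.
  have hint := intervalIntegral.integrableOn_deriv_of_nonneg hcont hder hnn
  have hval := intervalIntegral.integral_eq_sub_of_hasDerivAt_of_le hx hcont hder
    ((intervalIntegrable_iff_integrableOn_Ioc_of_le hx).mpr hint)
  rw [← hval, intervalIntegral.integral_of_le hx, ← restrict_Ioo_eq_restrict_Ioc,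
    ofReal_integral_eq_lintegral_ofReal]
  · rw [restrict_Ioo_eq_restrict_Ioc]; exact hint
  · exact Filter.Eventually.of_forall fun x => by positivity

/-- With `φ₁`, `φ₂` the two arcsines, the sum-to-product formulas write the complex number as `2r
cos((φ₁ + φ₂)/2)` times the unit vector at angle `(φ₂ - φ₁)/2`. The cosine is positive because `φ₁ <
φ₂` both lie in `[-π/2, π/2]`. -/
theorem two_mul_arg_eq_arcsin_sub {x₁ x₂ y₁ y₂ c r : ℝ} (hr : 0 < r) (hx : x₁ < x₂) (hy₁ : 0 ≤ y₁)
    (hy₂ : 0 ≤ y₂) (h₁ : (x₁ - c) ^ 2 + y₁ ^ 2 = r ^ 2) (h₂ : (x₂ - c) ^ 2 + y₂ ^ 2 = r ^ 2) :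
    2 * Complex.arg ⟨y₁ + y₂, x₂ - x₁⟩ =
      Real.arcsin ((x₂ - c) / r) - Real.arcsin ((x₁ - c) / r) := by
  have hmem : ∀ x y : ℝ, (x - c) ^ 2 + y ^ 2 = r ^ 2 → (x - c) / r ∈ Set.Icc (-1 : ℝ) 1 := by
    intro x y h
    rw [Set.mem_Icc, ← abs_le, ← sq_le_one_iff_abs_le_one, div_pow, div_le_one (by positivity)]
    nlinarith [sq_nonneg y]
  have hcos : ∀ x y : ℝ, 0 ≤ y → (x - c) ^ 2 + y ^ 2 = r ^ 2 →
      r * Real.cos (Real.arcsin ((x - c) / r)) = y := by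
    intro x y hy h
    rw [Real.cos_arcsin, show 1 - ((x - c) / r) ^ 2 = (y / r) ^ 2 by field_simp; linarith,
      Real.sqrt_sq (by positivity)]
    field_simp
  have hsin : ∀ x y : ℝ, (x - c) ^ 2 + y ^ 2 = r ^ 2 →
      r * Real.sin (Real.arcsin ((x - c) / r)) = x - c := by
    intro x y h
    rw [Real.sin_arcsin (hmem x y h).1 (hmem x y h).2]
    field_simp
  have hlt : Real.arcsin ((x₁ - c) / r) < Real.arcsin ((x₂ - c) / r) :=
    Real.strictMonoOn_arcsin (hmem _ _ h₁) (hmem _ _ h₂) (by gcongr)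
  have c₁ := hcos _ _ hy₁ h₁
  have c₂ := hcos _ _ hy₂ h₂
  have s₁ := hsin _ _ h₁
  have s₂ := hsin _ _ h₂
  have l₁ := Real.neg_pi_div_two_le_arcsin ((x₁ - c) / r)
  have l₂ := Real.neg_pi_div_two_le_arcsin ((x₂ - c) / r)
  have u₁ := Real.arcsin_le_pi_div_two ((x₁ - c) / r)
  have u₂ := Real.arcsin_le_pi_div_two ((x₂ - c) / r)
  generalize Real.arcsin ((x₁ - c) / r) = φ₁ at *
  generalize Real.arcsin ((x₂ - c) / r) = φ₂ at *
  have hpos : 0 < r * (2 * Real.cos ((φ₁ + φ₂) / 2)) := by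
    have := Real.cos_pos_of_mem_Ioo (x := (φ₁ + φ₂) / 2) ⟨by linarith, by linarith⟩
    positivity
  have hc := Real.cos_add_cos φ₁ φ₂
  have hs := Real.sin_sub_sin φ₂ φ₁
  have e : (⟨y₁ + y₂, x₂ - x₁⟩ : ℂ) = (r * (2 * Real.cos ((φ₁ + φ₂) / 2)) : ℝ) *
      (Complex.cos ((φ₂ - φ₁) / 2 : ℝ) + Complex.sin ((φ₂ - φ₁) / 2 : ℝ) * Complex.I) := by
    rw [← Complex.ofReal_cos, ← Complex.ofReal_sin]
    apply Complex.ext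
    · rw [Complex.re_ofReal_mul]
      simp only [Complex.add_re, Complex.ofReal_re, Complex.mul_I_re, Complex.ofReal_im, neg_zero,
        add_zero]
      rw [← c₁, ← c₂, ← mul_add, hc, show (φ₁ - φ₂) / 2 = -((φ₂ - φ₁) / 2) by ring, Real.cos_neg]
      ring
    · rw [Complex.im_ofReal_mul]
      simp only [Complex.add_im, Complex.ofReal_im, Complex.mul_I_im, Complex.ofReal_re, zero_add]
      rw [show x₂ - x₁ = (x₂ - c) - (x₁ - c) by ring, ← s₁, ← s₂, ← mul_sub, hs,
        show (φ₁ + φ₂) / 2 = (φ₂ + φ₁) / 2 by ring]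
      ring
  have hpi := Real.pi_pos
  rw [e, Complex.arg_mul_cos_add_sin_mul_I hpos ⟨by linarith, by linarith⟩]
  ring

theorem volume_strip_above_circle {x₁ x₂ y₁ y₂ : ℝ} (hx : x₁ < x₂) (hy₁ : 0 ≤ y₁) (hy₂ : 0 ≤ y₂) :
    volume {z : ℍ | 0 < z.re - x₁ ∧ 0 < x₂ - z.re ∧
      0 < (x₂ - x₁) * (z.re ^ 2 + z.im ^ 2) - (x₂ ^ 2 + y₂ ^ 2 - (x₁ ^ 2 + y₁ ^ 2)) * z.re +
        (x₁ * (x₂ ^ 2 + y₂ ^ 2) - x₂ * (x₁ ^ 2 + y₁ ^ 2))} =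
      ENNReal.ofReal (2 * Complex.arg ⟨y₁ + y₂, x₂ - x₁⟩) := by
  have hd : 0 < x₂ - x₁ := sub_pos.mpr hx
  -- The centre, on the real line, of the half-circle through the two points.
  set c := (x₂ ^ 2 + y₂ ^ 2 - (x₁ ^ 2 + y₁ ^ 2)) / (2 * (x₂ - x₁)) with hc
  have hcd : x₂ ^ 2 + y₂ ^ 2 - (x₁ ^ 2 + y₁ ^ 2) = 2 * c * (x₂ - x₁) := by
    rw [hc]; field_simp
  have hrad : 0 < (x₁ - c) ^ 2 + y₁ ^ 2 := by
    by_contra h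
    have h1 : (x₁ - c) ^ 2 = 0 := by nlinarith [sq_nonneg (x₁ - c), sq_nonneg y₁]
    have h2 : y₁ ^ 2 = 0 := by nlinarith [sq_nonneg (x₁ - c), sq_nonneg y₁]
    have h3 : x₁ = c := by nlinarith [pow_eq_zero_iff (two_ne_zero) |>.mp h1]
    rw [← h3] at hcd
    nlinarith [sq_nonneg y₂, mul_pos hd hd]
  obtain ⟨r, hr, hr2⟩ : ∃ r : ℝ, 0 < r ∧ r ^ 2 = (x₁ - c) ^ 2 + y₁ ^ 2 :=
    ⟨_, Real.sqrt_pos.mpr hrad, Real.sq_sqrt hrad.le⟩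
  have h₁ : (x₁ - c) ^ 2 + y₁ ^ 2 = r ^ 2 := hr2.symm
  have h₂ : (x₂ - c) ^ 2 + y₂ ^ 2 = r ^ 2 := by rw [hr2]; linear_combination hcd
  have hpos : ∀ x ∈ Set.Ioo x₁ x₂, 0 < r ^ 2 - (x - c) ^ 2 := by
    rintro x ⟨hx1, hx2⟩
    -- The squared height is concave in `x` with end values `y₁²` and `y₂²`; this is linear
    -- interpolation plus the strictly positive excess, which is what remains when both ends are
    -- ideal.
    have e : (x₂ - x₁) * (r ^ 2 - (x - c) ^ 2) =
        (x₂ - x₁) * (x - x₁) * (x₂ - x) + (x₂ - x) * y₁ ^ 2 + (x - x₁) * y₂ ^ 2 := by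
      linear_combination (-(x₂ - x)) * h₁ - (x - x₁) * h₂
    have : 0 < (x₂ - x₁) * (r ^ 2 - (x - c) ^ 2) := by
      rw [e]
      have a1 : 0 < x - x₁ := sub_pos.mpr hx1
      have a2 : 0 < x₂ - x := sub_pos.mpr hx2
      positivity
    exact pos_of_mul_pos_right this hd.le
  rw [two_mul_arg_eq_arcsin_sub hr hx hy₁ hy₂ h₁ h₂, ← lintegral_one_div_sqrt hr hx.le hpos,
    ← volume_region_eq_lintegral (f := fun x => √(r ^ 2 - (x - c) ^ 2)) (by fun_prop)
      fun x hx => Real.sqrt_pos.mpr (hpos x hx)]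
  congr 1
  ext z
  have hz := z.im_pos
  have e : (x₂ - x₁) * (z.re ^ 2 + z.im ^ 2) - (x₂ ^ 2 + y₂ ^ 2 - (x₁ ^ 2 + y₁ ^ 2)) * z.re +
        (x₁ * (x₂ ^ 2 + y₂ ^ 2) - x₂ * (x₁ ^ 2 + y₁ ^ 2)) =
      (x₂ - x₁) * (z.im ^ 2 - (r ^ 2 - (z.re - c) ^ 2)) := by
    rw [hr2]
    linear_combination (x₁ - z.re) * hcd
  rw [Set.mem_ofPred_eq, Set.mem_ofPred_eq, e, mul_pos_iff_of_pos_left hd, sub_pos, sub_pos, sub_pos,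
    Real.sqrt_lt' hz, Set.mem_Ioo, and_assoc]

/-! ### Symmetries of the signed area -/

theorem orientation_eq (A B C : ClosedPlane) : orientation A B C =
    projCoord A 0 * (projCoord B 1 * projCoord C 2 - projCoord B 2 * projCoord C 1) -
    projCoord A 1 * (projCoord B 0 * projCoord C 2 - projCoord B 2 * projCoord C 0) +
    projCoord A 2 * (projCoord B 0 * projCoord C 1 - projCoord B 1 * projCoord C 0) := by
  refine (Matrix.det_fin_three (Matrix.of ![projCoord A, projCoord B, projCoord C])).trans ?_
  simp only [Matrix.of_apply, Matrix.cons_val]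
  ring

theorem orientation_swap (A B C : ClosedPlane) : orientation B A C = -orientation A B C := by
  rw [orientation_eq, orientation_eq]; ring

theorem orientation_self (A C : ClosedPlane) : orientation A A C = 0 := by
  rw [orientation_eq]; ring

theorem leftTriangle_rotate (A B C : ClosedPlane) : leftTriangle B C A = leftTriangle A B C := by
  ext z
  simp only [leftTriangle, Set.mem_ofPred_eq]
  tauto

theorem signedArea_rotate (A B C : ClosedPlane) : signedArea B C A = signedArea A B C := by
  rw [signedArea, signedArea, leftTriangle_rotate A B C, ← leftTriangle_rotate A C B,
    ← leftTriangle_rotate C B A]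

theorem signedArea_swap (A B C : ClosedPlane) : signedArea A C B = -signedArea A B C := by
  rw [signedArea, signedArea, neg_sub]

theorem leftTriangle_self (A C : ClosedPlane) : leftTriangle A A C = ∅ := by
  ext z
  simp [leftTriangle, orientation_self]

theorem signedArea_self (A C : ClosedPlane) : signedArea A A C = 0 := by
  rw [signedArea, leftTriangle_self, ← leftTriangle_rotate A C A, ← leftTriangle_rotate C A A,
    leftTriangle_self]
  simp

theorem signedArea_self_right (A C : ClosedPlane) : signedArea A C C = 0 := by
  rw [← signedArea_rotate, signedArea_self]

/-! ### The action in projective coordinates, and invariance of orientation and area. -/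

theorem projCoord_inl (z : ℍ) : projCoord (.inl z) = ![1, z.re, z.re ^ 2 + z.im ^ 2] := by
  simp [projCoord, Complex.normSq_apply, pow_two]

theorem projCoord_infty : projCoord (.inr OnePoint.infty) = ![0, 0, 1] := rfl

theorem projCoord_coe (x : ℝ) : projCoord (.inr (x : OnePoint ℝ)) = ![1, x, x ^ 2] := rfl

theorem mk_smul_boundary (g : SL(2, ℝ)) (x : OnePoint ℝ) :
    (QuotientGroup.mk g : PSL(2, ℝ)) • x = Matrix.SpecialLinearGroup.mapGL ℝ g • x := rfl

theorem mk_smul_infty (g : SL(2, ℝ)) :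
    (QuotientGroup.mk g : PSL(2, ℝ)) • (OnePoint.infty : OnePoint ℝ) =
      if g 1 0 = 0 then OnePoint.infty else ((g 0 0 / g 1 0 : ℝ) : OnePoint ℝ) := by
  rw [mk_smul_boundary, OnePoint.smul_infty_eq_ite]
  simp

theorem mk_smul_coe (g : SL(2, ℝ)) (x : ℝ) :
    (QuotientGroup.mk g : PSL(2, ℝ)) • (x : OnePoint ℝ) =
      if g 1 0 * x + g 1 1 = 0 then OnePoint.infty else
        (((g 0 0 * x + g 0 1) / (g 1 0 * x + g 1 1) : ℝ) : OnePoint ℝ) := by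
  rw [mk_smul_boundary, OnePoint.smul_some_eq_ite]
  simp

theorem smul_inl (g : PSL(2, ℝ)) (z : ℍ) : g • (.inl z : ClosedPlane) = .inl (g • z) := rfl

theorem smul_inr (g : PSL(2, ℝ)) (x : OnePoint ℝ) : g • (.inr x : ClosedPlane) = .inr (g • x) := rfl

/-- On projective coordinates `g` acts through its symmetric square. The scalar is `|cz + d|²` or
its analogue at an ideal point; its positivity is what preserves the sign of determinants. -/
theorem exists_projCoord_smul (g : SL(2, ℝ)) (A : ClosedPlane) : ∃ r : ℝ, 0 < r ∧
    r * projCoord ((QuotientGroup.mk g : PSL(2, ℝ)) • A) 0 =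
      g 1 1 ^ 2 * projCoord A 0 + 2 * g 1 0 * g 1 1 * projCoord A 1 + g 1 0 ^ 2 * projCoord A 2 ∧
    r * projCoord ((QuotientGroup.mk g : PSL(2, ℝ)) • A) 1 =
      g 0 1 * g 1 1 * projCoord A 0 + (g 0 0 * g 1 1 + g 0 1 * g 1 0) * projCoord A 1 +
        g 0 0 * g 1 0 * projCoord A 2 ∧
    r * projCoord ((QuotientGroup.mk g : PSL(2, ℝ)) • A) 2 =
      g 0 1 ^ 2 * projCoord A 0 + 2 * g 0 0 * g 0 1 * projCoord A 1 + g 0 0 ^ 2 * projCoord A 2 := by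
  have hdet := sl_det g
  rcases A with z | x
  · have hd := denom_ne g z
    set w : ℍ := (QuotientGroup.mk g : PSL(2, ℝ)) • z with hw
    have e : (w : ℂ) * ((g 1 0 : ℝ) * (z : ℂ) + (g 1 1 : ℝ)) =
        (g 0 0 : ℝ) * (z : ℂ) + (g 0 1 : ℝ) := by
      rw [hw, coe_mk_smul, div_mul_cancel₀ _ hd]
    have hpos : 0 < Complex.normSq ((g 1 0 : ℝ) * (z : ℂ) + (g 1 1 : ℝ)) := Complex.normSq_pos.mpr hd
    have e1 := congrArg Complex.re e
    have e2 := congrArg Complex.im e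
    rw [Complex.normSq_apply] at hpos
    simp only [Complex.add_re, Complex.add_im, Complex.mul_re, Complex.mul_im, Complex.ofReal_re,
      Complex.ofReal_im, zero_mul, sub_zero, add_zero, UpperHalfPlane.coe_re,
      UpperHalfPlane.coe_im] at e1 e2 hpos
    refine ⟨_, hpos, ?_, ?_, ?_⟩
    · rw [smul_inl, ← hw, projCoord_inl, projCoord_inl]
      simp only [Matrix.cons_val]
      ring
    · rw [smul_inl, ← hw, projCoord_inl, projCoord_inl]
      simp only [Matrix.cons_val]
      linear_combination (g 1 0 * z.re + g 1 1) * e1 + g 1 0 * z.im * e2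
    · rw [smul_inl, ← hw, projCoord_inl, projCoord_inl]
      simp only [Matrix.cons_val]
      linear_combination (w.re * (g 1 0 * z.re + g 1 1) - w.im * (g 1 0 * z.im) +
        (g 0 0 * z.re + g 0 1)) * e1 +
        (w.re * (g 1 0 * z.im) + w.im * (g 1 0 * z.re + g 1 1) + g 0 0 * z.im) * e2
  · cases x with
    | infty =>
      rw [smul_inr, mk_smul_infty]
      by_cases hc : g 1 0 = 0
      · have ha : g 0 0 ≠ 0 := fun h => by rw [h, hc] at hdet; norm_num at hdet
        refine ⟨g 0 0 ^ 2, by positivity, ?_⟩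
        rw [if_pos hc, projCoord_infty]
        simp only [Matrix.cons_val, hc]
        norm_num
      · refine ⟨g 1 0 ^ 2, by positivity, ?_⟩
        rw [if_neg hc, projCoord_infty, projCoord_coe]
        simp only [Matrix.cons_val]
        refine ⟨by ring, ?_, ?_⟩ <;> field_simp <;> ring
    | coe x =>
      rw [smul_inr, mk_smul_coe]
      by_cases hc : g 1 0 * x + g 1 1 = 0
      · have hn : g 0 0 * x + g 0 1 ≠ 0 := fun h => by
          have : (1 : ℝ) = 0 := by linear_combination g 0 0 * hc - g 1 0 * h - hdet
          norm_num at this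
        refine ⟨(g 0 0 * x + g 0 1) ^ 2, by positivity, ?_⟩
        rw [if_pos hc, projCoord_infty, projCoord_coe]
        simp only [Matrix.cons_val]
        refine ⟨?_, ?_, by ring⟩
        · linear_combination -(g 1 0 * x + g 1 1) * hc
        · linear_combination -(g 0 0 * x + g 0 1) * hc
      · refine ⟨(g 1 0 * x + g 1 1) ^ 2, by positivity, ?_⟩
        rw [if_neg hc, projCoord_coe, projCoord_coe]
        simp only [Matrix.cons_val]
        refine ⟨by ring, ?_, ?_⟩ <;> field_simp <;> ring

theorem exists_orientation_smul (g : PSL(2, ℝ)) (A B C : ClosedPlane) :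
    ∃ r : ℝ, 0 < r ∧ r * orientation (g • A) (g • B) (g • C) = orientation A B C := by
  induction g using QuotientGroup.induction_on with | H g
  obtain ⟨r, hr, a0, a1, a2⟩ := exists_projCoord_smul g A
  obtain ⟨s, hs, b0, b1, b2⟩ := exists_projCoord_smul g B
  obtain ⟨t, ht, c0, c1, c2⟩ := exists_projCoord_smul g C
  refine ⟨r * s * t, by positivity, ?_⟩
  rw [orientation_eq, orientation_eq]
  generalize projCoord ((QuotientGroup.mk g : PSL(2, ℝ)) • A) = A' at *
  generalize projCoord ((QuotientGroup.mk g : PSL(2, ℝ)) • B) = B' at *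
  generalize projCoord ((QuotientGroup.mk g : PSL(2, ℝ)) • C) = C' at *
  have e : r * s * t * (A' 0 * (B' 1 * C' 2 - B' 2 * C' 1) - A' 1 * (B' 0 * C' 2 - B' 2 * C' 0) +
      A' 2 * (B' 0 * C' 1 - B' 1 * C' 0)) =
      (r * A' 0) * ((s * B' 1) * (t * C' 2) - (s * B' 2) * (t * C' 1)) -
      (r * A' 1) * ((s * B' 0) * (t * C' 2) - (s * B' 2) * (t * C' 0)) +
      (r * A' 2) * ((s * B' 0) * (t * C' 1) - (s * B' 1) * (t * C' 0)) := by ring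
  rw [e, a0, a1, a2, b0, b1, b2, c0, c1, c2]
  have hdet := sl_det g
  -- The determinant of the symmetric square of a `2 × 2` matrix is the cube of its determinant.
  have h3 : (g 0 0 * g 1 1 - g 0 1 * g 1 0) ^ 3 = 1 := by rw [hdet]; norm_num
  linear_combination (projCoord A 0 * (projCoord B 1 * projCoord C 2 - projCoord B 2 * projCoord C 1) -
    projCoord A 1 * (projCoord B 0 * projCoord C 2 - projCoord B 2 * projCoord C 0) +
    projCoord A 2 * (projCoord B 0 * projCoord C 1 - projCoord B 1 * projCoord C 0)) * h3

theorem orientation_smul_pos_iff (g : PSL(2, ℝ)) (A B C : ClosedPlane) :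
    0 < orientation (g • A) (g • B) (g • C) ↔ 0 < orientation A B C := by
  obtain ⟨r, hr, h⟩ := exists_orientation_smul g A B C
  rw [← h, mul_pos_iff_of_pos_left hr]

theorem leftTriangle_smul (g : PSL(2, ℝ)) (A B C : ClosedPlane) :
    (fun z : ℍ => g • z) ⁻¹' leftTriangle (g • A) (g • B) (g • C) = leftTriangle A B C := by
  ext z
  simp only [leftTriangle, Set.mem_preimage, Set.mem_ofPred_eq, ← smul_inl, orientation_smul_pos_iff]

theorem volume_preimage_smul (g : PSL(2, ℝ)) (s : Set ℍ) :
    volume ((fun z : ℍ => g • z) ⁻¹' s) = volume s := by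
  induction g using QuotientGroup.induction_on with | H g
  exact measure_preimage_smul volume (Matrix.SpecialLinearGroup.mapGL ℝ g) s

theorem signedArea_smul (g : PSL(2, ℝ)) (A B C : ClosedPlane) :
    signedArea (g • A) (g • B) (g • C) = signedArea A B C := by
  rw [signedArea, signedArea, ← leftTriangle_smul g A B C, ← leftTriangle_smul g A C B,
    volume_preimage_smul, volume_preimage_smul]

/-! ### Triangles with a vertex at infinity -/

theorem volume_leftTriangle_infty {A B : ClosedPlane} {x₁ y₁ x₂ y₂ : ℝ}
    (hA : projCoord A = ![1, x₁, x₁ ^ 2 + y₁ ^ 2]) (hB : projCoord B = ![1, x₂, x₂ ^ 2 + y₂ ^ 2])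
    (hy₁ : 0 ≤ y₁) (hy₂ : 0 ≤ y₂) :
    volume (leftTriangle (.inr OnePoint.infty) A B) =
      if x₁ < x₂ then ENNReal.ofReal (2 * Complex.arg ⟨y₁ + y₂, x₂ - x₁⟩) else 0 := by
  have hset : leftTriangle (.inr OnePoint.infty) A B = {z : ℍ | 0 < z.re - x₁ ∧ 0 < x₂ - z.re ∧
      0 < (x₂ - x₁) * (z.re ^ 2 + z.im ^ 2) - (x₂ ^ 2 + y₂ ^ 2 - (x₁ ^ 2 + y₁ ^ 2)) * z.re +
        (x₁ * (x₂ ^ 2 + y₂ ^ 2) - x₂ * (x₁ ^ 2 + y₁ ^ 2))} := by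
    ext z
    have e1 : orientation (.inr OnePoint.infty) A (.inl z) = z.re - x₁ := by
      rw [orientation_eq, hA, projCoord_infty, projCoord_inl]
      simp only [Matrix.cons_val]
      ring
    have e2 : orientation B (.inr OnePoint.infty) (.inl z) = x₂ - z.re := by
      rw [orientation_eq, hB, projCoord_infty, projCoord_inl]
      simp only [Matrix.cons_val]
      ring
    have e3 : orientation A B (.inl z) = (x₂ - x₁) * (z.re ^ 2 + z.im ^ 2) -
        (x₂ ^ 2 + y₂ ^ 2 - (x₁ ^ 2 + y₁ ^ 2)) * z.re +
        (x₁ * (x₂ ^ 2 + y₂ ^ 2) - x₂ * (x₁ ^ 2 + y₁ ^ 2)) := by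
      rw [orientation_eq, hA, hB, projCoord_inl]
      simp only [Matrix.cons_val]
      ring
    simp only [leftTriangle, Set.mem_ofPred_eq, e1, e2, e3]
    tauto
  rw [hset]
  split_ifs with h
  · exact volume_strip_above_circle h hy₁ hy₂
  · convert! measure_empty (μ := (volume : Measure ℍ))
    refine Set.eq_empty_iff_forall_notMem.mpr fun z hz => h ?_
    linarith [hz.1, hz.2.1]

/-- Allowing height `0` covers ideal vertices as well. Oddness of the argument under conjugation
matches the change of sign when the vertices are exchanged. -/
theorem signedArea_infty {A B : ClosedPlane} {x₁ y₁ x₂ y₂ : ℝ}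
    (hA : projCoord A = ![1, x₁, x₁ ^ 2 + y₁ ^ 2]) (hB : projCoord B = ![1, x₂, x₂ ^ 2 + y₂ ^ 2])
    (hy₁ : 0 ≤ y₁) (hy₂ : 0 ≤ y₂) :
    signedArea (.inr OnePoint.infty) A B = 2 * Complex.arg ⟨y₁ + y₂, x₂ - x₁⟩ := by
  rw [signedArea, volume_leftTriangle_infty hA hB hy₁ hy₂, volume_leftTriangle_infty hB hA hy₂ hy₁]
  rcases lt_trichotomy x₁ x₂ with h | h | h
  · rw [if_pos h, if_neg h.not_gt, ENNReal.toReal_zero, sub_zero, ENNReal.toReal_ofReal]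
    have : 0 ≤ Complex.arg ⟨y₁ + y₂, x₂ - x₁⟩ := Complex.arg_nonneg_iff.mpr (sub_pos.mpr h).le
    linarith
  · rw [if_neg h.not_lt, if_neg h.not_gt, sub_self, h, sub_self]
    have : Complex.arg ⟨y₁ + y₂, 0⟩ = 0 := Complex.arg_eq_zero_iff.mpr ⟨add_nonneg hy₁ hy₂, rfl⟩
    rw [this, mul_zero]
  · rw [if_neg h.not_gt, if_pos h, ENNReal.toReal_zero, zero_sub, ENNReal.toReal_ofReal]
    · have e : (⟨y₁ + y₂, x₂ - x₁⟩ : ℂ) = (starRingEnd ℂ) ⟨y₂ + y₁, x₁ - x₂⟩ := by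
        apply Complex.ext <;> simp [add_comm]
      rw [e, Complex.arg_conj, if_neg]
      · ring
      · intro h'
        exact (sub_pos.mpr h).ne' (Complex.arg_eq_pi_iff.mp h').2
    · have : 0 ≤ Complex.arg ⟨y₂ + y₁, x₁ - x₂⟩ := Complex.arg_nonneg_iff.mpr (sub_pos.mpr h).le
      linarith

theorem signedArea_infty_inl (z w : ℍ) :
    signedArea (.inr OnePoint.infty) (.inl z) (.inl w) = 2 * halfAngle z w :=
  signedArea_infty (projCoord_inl z) (projCoord_inl w) z.im_pos.le w.im_pos.le

theorem abs_signedArea_infty_le (A B : ClosedPlane) :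
    |signedArea (.inr OnePoint.infty) A B| ≤ Real.pi := by
  have hfin : ∀ C : ClosedPlane, C = .inr OnePoint.infty ∨
      ∃ x y : ℝ, 0 ≤ y ∧ projCoord C = ![1, x, x ^ 2 + y ^ 2] := by
    rintro (z | x)
    · exact Or.inr ⟨z.re, z.im, z.im_pos.le, projCoord_inl z⟩
    · cases x with
      | infty => exact Or.inl rfl
      | coe x => exact Or.inr ⟨x, 0, le_rfl, by rw [projCoord_coe]; simp⟩
  rcases hfin A with rfl | ⟨x₁, y₁, hy₁, hA⟩
  · rw [signedArea_self, abs_zero]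
    exact Real.pi_pos.le
  rcases hfin B with rfl | ⟨x₂, y₂, hy₂, hB⟩
  · rw [← signedArea_rotate, ← signedArea_rotate, signedArea_self, abs_zero]
    exact Real.pi_pos.le
  rw [signedArea_infty hA hB hy₁ hy₂, abs_mul, abs_two]
  have : |Complex.arg ⟨y₁ + y₂, x₂ - x₁⟩| ≤ Real.pi / 2 :=
    Complex.abs_arg_le_pi_div_two_iff.mpr (add_nonneg hy₁ hy₂)
  linarith

/-! ### The area of a triangle in the plane -/

theorem proj_surjective (g : PSL(2, ℝ)) : ∃ a : UniversalCover PSL(2, ℝ), a.proj = g := by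
  set y := UpperHalfPlane.I
  set φ := Complex.arg (derivFactor g y) with hφ
  have hg : g = frame y (g • y) φ := by
    refine eq_frame g y φ ?_
    rw [mul_comm Complex.I, hφ, Complex.norm_mul_exp_arg_mul_I]
  have hw : Continuous fun t : I => segmentPoint t y (g • y) :=
    Continuous.segmentPoint continuous_id continuous_const continuous_const
  have hp : Continuous fun t : I => (t : ℝ) * φ := by fun_prop
  refine ⟨UniversalCover.mk ⟨framePath y ⟨_, hw⟩ ⟨_, hp⟩, framePath_zero _ _ _ ?_ ?_⟩, ?_⟩
  · exact segmentPoint_zero _ _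
  · simp
  · rw [proj_mk]
    change frame y (segmentPoint 1 y (g • y)) (((1 : I) : ℝ) * φ) = g
    rw [segmentPoint_one, Set.Icc.coe_one, one_mul]
    exact hg.symm

/-- Lift `g` to the universal cover and add the base point change of `rot` over the three sides: the
rotations telescope around the triangle. -/
theorem triangleAngle_smul (g : PSL(2, ℝ)) (x y z : ℍ) :
    triangleAngle (g • x : ℍ) (g • y : ℍ) (g • z : ℍ) = triangleAngle x y z := by
  obtain ⟨a, rfl⟩ := proj_surjective g
  have h1 := rot_change a y x
  have h2 := rot_change a z y
  have h3 := rot_change a x z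
  rw [triangleAngle, triangleAngle]
  linarith

theorem triangleAngle_self_left (x z : ℍ) : triangleAngle x x z = 0 := by
  rw [triangleAngle, halfAngle_self, halfAngle_swap x z]
  ring

theorem triangleAngle_self_right (x z : ℍ) : triangleAngle x z z = 0 := by
  rw [triangleAngle, halfAngle_self, halfAngle_swap x z]
  ring

theorem measurableSet_leftTriangle (A B C : ClosedPlane) : MeasurableSet (leftTriangle A B C) := by
  have h : ∀ A B : ClosedPlane, MeasurableSet {z : ℍ | 0 < orientation A B (.inl z)} := by
    intro A B
    have hre : Continuous fun z : ℍ => z.re := UpperHalfPlane.continuous_re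
    have him : Continuous fun z : ℍ => z.im := UpperHalfPlane.continuous_im
    refine (isOpen_lt continuous_const ?_).measurableSet
    simp only [orientation_eq, projCoord_inl, Matrix.cons_val]
    fun_prop
  exact (h A B).inter ((h B C).inter (h C A))

theorem volume_re_eq_zero : volume {z : ℍ | z.re = 0} = 0 := by
  have h : {z : ℍ | z.re = 0} = {z : ℍ | (z.re, z.im) ∈ ({0} ×ˢ Set.Ioi 0 : Set (ℝ × ℝ))} := by
    ext z
    simp [z.im_pos]
  rw [h, volume_eq_lintegral_real_prod _ ((measurableSet_singleton 0).prod measurableSet_Ioi)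
    fun p hp => hp.2]
  refine setLIntegral_measure_zero _ _ ?_
  rw [Measure.volume_eq_prod, Measure.prod_prod, Real.volume_singleton, zero_mul]

theorem projCoord_axisPoint (s : ℝ) : projCoord (.inl (axisPoint s)) = ![1, 0, Real.exp s ^ 2] := by
  rw [projCoord_inl, axisPoint_re, axisPoint_im]
  norm_num

/-- The set is a complete geodesic; an isometry carries it to the imaginary axis, which is null. -/
theorem volume_orientation_eq_zero {x y : ℍ} (hxy : x ≠ y) :
    volume {z : ℍ | orientation (.inl x) (.inl y) (.inl z) = 0} = 0 := by
  obtain ⟨h, d, hd, rfl, rfl⟩ := exists_geodesic x y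
  have hd0 : Real.exp d ^ 2 - 1 ≠ 0 := by
    intro h0
    apply hxy
    have : d = 0 := by
      rw [← Real.exp_nat_mul, sub_eq_zero, Real.exp_eq_one_iff] at h0
      simpa using h0
    rw [this]
  rw [← volume_preimage_smul h, ← volume_re_eq_zero]
  congr 1
  ext z
  change orientation (h • .inl (axisPoint 0)) (h • .inl (axisPoint d)) (h • .inl z) = 0 ↔ z.re = 0
  obtain ⟨r, hr, e⟩ := exists_orientation_smul h (.inl (axisPoint 0)) (.inl (axisPoint d)) (.inl z)
  have e' : orientation (.inl (axisPoint 0)) (.inl (axisPoint d)) (.inl z) =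
      -(Real.exp d ^ 2 - 1) * z.re := by
    rw [orientation_eq, projCoord_axisPoint, projCoord_axisPoint, projCoord_inl]
    simp only [Matrix.cons_val, Real.exp_zero]
    ring
  rw [e'] at e
  constructor
  · intro h0
    rw [h0, mul_zero] at e
    exact (mul_eq_zero.mp e.symm).resolve_left (neg_ne_zero.mpr hd0)
  · intro h0
    rw [h0, mul_zero] at e
    exact (mul_eq_zero.mp e).resolve_left hr.ne'

/-- A positive combination puts `B` on the side `AQ`, so the segment `BC` cuts the triangle in two,
apart from a null set. The statement holds for either orientation, since clockwise triangles are
empty. -/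
theorem volume_leftTriangle_add {A B C Q : ClosedPlane} {s t : ℝ} (hs : 0 < s) (ht : 0 < t)
    (hB : ∀ i, projCoord B i = s * projCoord A i + t * projCoord Q i)
    (hnull : volume {z : ℍ | orientation B C (.inl z) = 0} = 0) :
    volume (leftTriangle A Q C) = volume (leftTriangle A B C) + volume (leftTriangle B Q C) := by
  have e1 : ∀ z, orientation A B z = t * orientation A Q z := by
    intro z
    simp only [orientation_eq, hB]
    ring
  have e2 : ∀ z, orientation B Q z = s * orientation A Q z := by
    intro z
    simp only [orientation_eq, hB]
    ring
  have e3 : ∀ z, orientation B C z = t * orientation Q C z - s * orientation C A z := by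
    intro z
    simp only [orientation_eq, hB]
    ring
  have e4 : ∀ z, orientation C B z = -orientation B C z := fun z => orientation_swap _ _ _
  have hdisj : Disjoint (leftTriangle A B C) (leftTriangle B Q C) := by
    refine Set.disjoint_left.mpr fun z h h' => ?_
    have h1 := h.2.1
    have h2 := h'.2.2
    rw [e4] at h2
    linarith
  rw [← measure_union hdisj (measurableSet_leftTriangle _ _ _)]
  refine measure_congr (Filter.eventuallyEq_set.mpr ?_)
  filter_upwards [measure_eq_zero_iff_ae_notMem.mp hnull] with z hz
  have hz : orientation B C (.inl z) ≠ 0 := hz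
  simp only [leftTriangle, Set.mem_union, Set.mem_ofPred_eq, e1, e2, e4,
    mul_pos_iff_of_pos_left hs, mul_pos_iff_of_pos_left ht]
  have e := e3 (.inl z)
  constructor
  · rintro ⟨h1, h2, h3⟩
    rcases lt_or_gt_of_ne hz with h | h
    · exact Or.inr ⟨h1, h2, by linarith⟩
    · exact Or.inl ⟨h1, h, h3⟩
  · rintro (⟨h1, h2, h3⟩ | ⟨h1, h2, h3⟩)
    · refine ⟨h1, ?_, h3⟩
      have := mul_pos hs h3
      exact pos_of_mul_pos_right (b := orientation Q C (.inl z)) (by linarith : 0 < t * _) ht.le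
    · refine ⟨h1, h2, ?_⟩
      have := mul_pos ht h2
      exact pos_of_mul_pos_right (b := orientation C A (.inl z)) (by linarith : 0 < s * _) hs.le

theorem volume_leftTriangle_infty_ne_top (z w : ℍ) :
    volume (leftTriangle (.inr OnePoint.infty) (.inl z) (.inl w)) ≠ ⊤ := by
  rw [volume_leftTriangle_infty (projCoord_inl z) (projCoord_inl w) z.im_pos.le w.im_pos.le]
  split_ifs
  · exact ENNReal.ofReal_ne_top
  · exact ENNReal.zero_ne_top

/-- The upper point of the axis lies between the lower one and `∞`, with weights `1` and `e^(2d) -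
1` in projective coordinates. Cutting there exhibits the triangle as a difference of two triangles
with vertex `∞`; the cut is made in both orders because signed area involves both orientations. -/
theorem signedArea_axis {d : ℝ} (hd : 0 < d) {z : ℍ} (hz : axisPoint d ≠ z) :
    signedArea (.inl (axisPoint 0)) (.inl (axisPoint d)) (.inl z) =
      2 * halfAngle z (axisPoint 0) - 2 * halfAngle z (axisPoint d) := by
  have ht : 0 < Real.exp d ^ 2 - 1 := by
    have := Real.one_lt_exp_iff.mpr hd
    nlinarith
  have hB : ∀ i, projCoord (.inl (axisPoint d)) i =
      1 * projCoord (.inl (axisPoint 0)) i + (Real.exp d ^ 2 - 1) * projCoord (.inr OnePoint.infty) i := by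
    intro i
    rw [projCoord_axisPoint, projCoord_axisPoint, projCoord_infty]
    fin_cases i <;> simp
  have hB' : ∀ i, projCoord (.inl (axisPoint d)) i =
      (Real.exp d ^ 2 - 1) * projCoord (.inr OnePoint.infty) i + 1 * projCoord (.inl (axisPoint 0)) i := by
    intro i
    rw [hB, add_comm]
  have hnull := volume_orientation_eq_zero hz
  have h1 := volume_leftTriangle_add one_pos ht hB hnull
  have h2 := volume_leftTriangle_add ht one_pos hB' hnull
  rw [← signedArea_infty_inl, ← signedArea_infty_inl, signedArea, signedArea, signedArea]
  rw [← leftTriangle_rotate (.inl (axisPoint 0)) (.inr OnePoint.infty),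
    ← leftTriangle_rotate (.inl (axisPoint d)) (.inr OnePoint.infty)] at h1
  rw [leftTriangle_rotate (.inl (axisPoint d)) (.inl (axisPoint 0)) (.inl z)]
  have hfin := volume_leftTriangle_infty_ne_top z (axisPoint 0)
  have hfin' := volume_leftTriangle_infty_ne_top (axisPoint 0) z
  rw [h1] at hfin
  rw [h2] at hfin'
  rw [h1, h2, ENNReal.toReal_add (fun h => hfin (by rw [h, top_add])) fun h => hfin (by rw [h, add_top]),
    ENNReal.toReal_add (fun h => hfin' (by rw [h, top_add])) fun h => hfin' (by rw [h, add_top])]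
  ring

theorem triangleAngle_axis (d : ℝ) (z : ℍ) :
    triangleAngle (axisPoint 0) (axisPoint d) z =
      2 * halfAngle z (axisPoint 0) - 2 * halfAngle z (axisPoint d) := by
  rw [triangleAngle, halfAngle_axisPoint, halfAngle_swap z (axisPoint d)]
  ring

/-- Both sides are invariant under isometries, so one side may be placed on the imaginary axis. -/
theorem signedArea_inl (x y z : ℍ) :
    signedArea (.inl x) (.inl y) (.inl z) = triangleAngle x y z := by
  obtain ⟨h, d, hd, rfl, rfl⟩ := exists_geodesic x y
  obtain ⟨w, rfl⟩ : ∃ w, h • w = z := ⟨h⁻¹ • z, smul_inv_smul h z⟩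
  rw [geodesic, geodesic, triangleAngle_smul, ← smul_inl, ← smul_inl, ← smul_inl, signedArea_smul]
  rcases hd.eq_or_lt with rfl | hd
  · rw [signedArea_self, triangleAngle_self_left]
  by_cases hw : axisPoint d = w
  · rw [hw, signedArea_self_right, triangleAngle_self_right]
  · rw [signedArea_axis hd hw, triangleAngle_axis]

theorem abs_halfAngle_lt (z w : ℍ) : |halfAngle z w| < Real.pi / 2 :=
  Complex.abs_arg_lt_pi_div_two_iff.mpr (Or.inl (kernel_re_pos z w))

/-- With one side on the axis, the angle is twice a difference of two half-angles. Both have the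
sign of `-re w` and absolute value less than `π/2`. -/
theorem abs_triangleAngle_lt (x y z : ℍ) : |triangleAngle x y z| < Real.pi := by
  obtain ⟨h, d, hd, rfl, rfl⟩ := exists_geodesic x y
  obtain ⟨w, rfl⟩ : ∃ w, h • w = z := ⟨h⁻¹ • z, smul_inv_smul h z⟩
  rw [geodesic, geodesic, triangleAngle_smul, triangleAngle_axis]
  have h1 := abs_lt.mp (abs_halfAngle_lt w (axisPoint 0))
  have h2 := abs_lt.mp (abs_halfAngle_lt w (axisPoint d))
  have him : ∀ s, (kernel w (axisPoint s)).im = -w.re := fun s => by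
    change (axisPoint s).re - w.re = -w.re
    rw [axisPoint_re, zero_sub]
  rw [abs_lt]
  rcases le_or_gt 0 (-w.re) with h | h
  · have a1 : 0 ≤ halfAngle w (axisPoint 0) := Complex.arg_nonneg_iff.mpr (by rw [him]; exact h)
    have a2 : 0 ≤ halfAngle w (axisPoint d) := Complex.arg_nonneg_iff.mpr (by rw [him]; exact h)
    constructor <;> linarith
  · have a1 : halfAngle w (axisPoint 0) < 0 := Complex.arg_neg_iff.mpr (by rw [him]; exact h)
    have a2 : halfAngle w (axisPoint d) < 0 := Complex.arg_neg_iff.mpr (by rw [him]; exact h)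
    constructor <;> linarith

/-! ### Limits along geodesics -/

theorem kernel_real_mul (r : ℝ) (z w : ℂ) : kernel (r * z) (r * w) = r * kernel z w := by
  simp only [kernel_eq, map_mul, Complex.conj_ofReal]
  ring

theorem tendsto_halfAngle {l : Filter ℝ} {f g : ℝ → ℂ} {z w : ℂ} (hf : Tendsto f l (𝓝 z))
    (hg : Tendsto g l (𝓝 w)) (h : kernel z w ∈ Complex.slitPlane) :
    Tendsto (fun s => halfAngle (f s) (g s)) l (𝓝 (halfAngle z w)) := by
  refine ((Complex.continuousAt_arg h).tendsto).comp ?_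
  exact (continuous_kernel.tendsto (z, w)).comp (hf.prodMk_nhds hg)

/-- The argument ignores positive scaling, so both points are rescaled by `e^(-s)`; the kernel then
tends to the positive real number `κ + μ`. A bounded trajectory has weight `0`, the axis itself
weight `1`. -/
theorem tendsto_halfAngle_zero {P Q : ℝ → ℂ} {κ μ : ℝ} (h : 0 < κ + μ)
    (hP : Tendsto (fun s => (Real.exp (-s) : ℂ) * P s) atTop (𝓝 (Complex.I * κ)))
    (hQ : Tendsto (fun s => (Real.exp (-s) : ℂ) * Q s) atTop (𝓝 (Complex.I * μ))) :
    Tendsto (fun s => halfAngle (P s) (Q s)) atTop (𝓝 0) := by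
  have hk : kernel (Complex.I * κ) (Complex.I * μ) = (κ + μ : ℝ) := by
    apply Complex.ext <;> simp [kernel]
  have h1 := tendsto_halfAngle hP hQ (by
    rw [hk]
    exact Complex.ofReal_mem_slitPlane.mpr h)
  rw [halfAngle, hk, Complex.arg_ofReal_of_nonneg h.le] at h1
  refine h1.congr fun s => ?_
  rw [halfAngle, kernel_real_mul, Complex.arg_real_mul _ (Real.exp_pos _), halfAngle]

theorem tendsto_exp_neg_coe : Tendsto (fun s : ℝ => (Real.exp (-s) : ℂ)) atTop (𝓝 0) := by
  have := Real.tendsto_exp_neg_atTop_nhds_zero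
  exact_mod_cast (Complex.continuous_ofReal.tendsto 0).comp this

theorem tendsto_exp_neg_mul_of_tendsto {P : ℝ → ℂ} {z : ℂ} (hP : Tendsto P atTop (𝓝 z)) :
    Tendsto (fun s => (Real.exp (-s) : ℂ) * P s) atTop (𝓝 (Complex.I * (0 : ℝ))) := by
  have := tendsto_exp_neg_coe.mul hP
  simpa using this

theorem exp_neg_mul_axisPoint (s : ℝ) : (Real.exp (-s) : ℂ) * axisPoint s = Complex.I := by
  rw [coe_axisPoint, mul_left_comm, ← Complex.ofReal_mul, ← Real.exp_add, neg_add_cancel,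
    Real.exp_zero, Complex.ofReal_one, mul_one]

theorem tendsto_exp_neg_mul_axisPoint :
    Tendsto (fun s => (Real.exp (-s) : ℂ) * axisPoint s) atTop (𝓝 (Complex.I * (1 : ℝ))) := by
  simp only [exp_neg_mul_axisPoint]
  simp

theorem tendsto_smul_axisPoint_of_fixes_infty {g : PSL(2, ℝ)}
    (hg : g • (OnePoint.infty : OnePoint ℝ) = OnePoint.infty) : ∃ κ : ℝ, 0 < κ ∧
    Tendsto (fun s => (Real.exp (-s) : ℂ) * (g • axisPoint s : ℍ)) atTop (𝓝 (Complex.I * κ)) := by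
  induction g using QuotientGroup.induction_on with | H g
  have hc : g 1 0 = 0 := by
    by_contra hc
    rw [mk_smul_infty, if_neg hc] at hg
    exact OnePoint.coe_ne_infty _ hg
  have hdet := sl_det g
  rw [hc, mul_zero, sub_zero] at hdet
  have hd : g 1 1 ≠ 0 := fun h => by rw [h] at hdet; norm_num at hdet
  have hdc : ((g 1 1 : ℝ) : ℂ) ≠ 0 := by exact_mod_cast hd
  have ha : g 0 0 / g 1 1 = g 0 0 ^ 2 := by
    rw [div_eq_iff hd]; linear_combination -g 0 0 * hdet
  have ha0 : g 0 0 ≠ 0 := fun h => by rw [h] at hdet; norm_num at hdet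
  refine ⟨g 0 0 / g 1 1, by rw [ha]; positivity, ?_⟩
  have e : ∀ s, (Real.exp (-s) : ℂ) * ((QuotientGroup.mk g : PSL(2, ℝ)) • axisPoint s : ℍ) =
      Complex.I * (g 0 0 / g 1 1 : ℝ) + (Real.exp (-s) : ℂ) * ((g 0 1 / g 1 1 : ℝ) : ℂ) := by
    intro s
    rw [coe_mk_smul, hc, Complex.ofReal_zero, zero_mul, zero_add]
    push_cast
    field_simp
    have := exp_neg_mul_axisPoint s
    push_cast at this
    linear_combination (g 0 0 : ℂ) * this
  simp only [e]
  have := (tendsto_exp_neg_coe.mul_const ((g 0 1 / g 1 1 : ℝ) : ℂ)).const_add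
    (Complex.I * (g 0 0 / g 1 1 : ℝ))
  rwa [zero_mul, add_zero] at this

theorem tendsto_smul_axisPoint_of_coe {g : PSL(2, ℝ)} {x : ℝ}
    (hg : g • (OnePoint.infty : OnePoint ℝ) = (x : OnePoint ℝ)) :
    Tendsto (fun s => ((g • axisPoint s : ℍ) : ℂ)) atTop (𝓝 (x : ℂ)) := by
  induction g using QuotientGroup.induction_on with | H g
  have hc : g 1 0 ≠ 0 := by
    intro hc
    rw [mk_smul_infty, if_pos hc] at hg
    exact OnePoint.infty_ne_coe _ hg
  rw [mk_smul_infty, if_neg hc, OnePoint.coe_eq_coe] at hg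
  have hcc : ((g 1 0 : ℝ) : ℂ) ≠ 0 := by exact_mod_cast hc
  have e : ∀ s, (((QuotientGroup.mk g : PSL(2, ℝ)) • axisPoint s : ℍ) : ℂ) =
      ((g 0 0 : ℝ) * Complex.I + (Real.exp (-s) : ℂ) * (g 0 1 : ℝ)) /
        ((g 1 0 : ℝ) * Complex.I + (Real.exp (-s) : ℂ) * (g 1 1 : ℝ)) := by
    intro s
    have h0 : (Real.exp (-s) : ℂ) ≠ 0 := by exact_mod_cast (Real.exp_pos _).ne'
    rw [coe_mk_smul, ← mul_div_mul_left _ _ h0, ← exp_neg_mul_axisPoint s]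
    congr 1 <;> ring
  simp only [e, ← hg]
  have h1 := (tendsto_exp_neg_coe.mul_const ((g 0 1 : ℝ) : ℂ)).const_add (((g 0 0 : ℝ) : ℂ) * Complex.I)
  have h2 := (tendsto_exp_neg_coe.mul_const ((g 1 1 : ℝ) : ℂ)).const_add (((g 1 0 : ℝ) : ℂ) * Complex.I)
  have h3 := h1.div h2 (by
    rw [zero_mul, add_zero]
    exact mul_ne_zero hcc Complex.I_ne_zero)
  rw [zero_mul, zero_mul, add_zero, add_zero, mul_div_mul_right _ _ Complex.I_ne_zero,
    ← Complex.ofReal_div] at h3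
  exact h3

theorem exists_tendsto_smul_axisPoint (g : PSL(2, ℝ)) : ∃ κ : ℝ, 0 ≤ κ ∧
    Tendsto (fun s => (Real.exp (-s) : ℂ) * (g • axisPoint s : ℍ)) atTop (𝓝 (Complex.I * κ)) := by
  rcases h : g • (OnePoint.infty : OnePoint ℝ) with _ | x
  · obtain ⟨κ, hκ, h'⟩ := tendsto_smul_axisPoint_of_fixes_infty h
    exact ⟨κ, hκ.le, h'⟩
  · exact ⟨0, le_rfl, tendsto_exp_neg_mul_of_tendsto (tendsto_smul_axisPoint_of_coe h)⟩

theorem triangleAngle_rotate (x y z : ℂ) : triangleAngle y z x = triangleAngle x y z := by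
  simp only [triangleAngle]; ring

theorem tendsto_triangleAngle_zero {P Q : ℝ → ℂ} {κ μ : ℝ} (hκ : 0 ≤ κ) (hμ : 0 ≤ μ)
    (h : 0 < κ + μ)
    (hP : Tendsto (fun s => (Real.exp (-s) : ℂ) * P s) atTop (𝓝 (Complex.I * κ)))
    (hQ : Tendsto (fun s => (Real.exp (-s) : ℂ) * Q s) atTop (𝓝 (Complex.I * μ))) :
    Tendsto (fun s => triangleAngle (axisPoint s) (P s) (Q s)) atTop (𝓝 0) := by
  have h1 := tendsto_halfAngle_zero (by linarith) tendsto_exp_neg_mul_axisPoint hP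
  have h2 := tendsto_halfAngle_zero h hP hQ
  have h3 := tendsto_halfAngle_zero (by linarith) hQ tendsto_exp_neg_mul_axisPoint
  have := ((h1.add h2).add h3).const_mul 2
  simpa [triangleAngle] using this

theorem tendsto_triangleAngle_of_tendsto {P Q : ℝ → ℂ} {z w : ℂ} (hP : Tendsto P atTop (𝓝 z))
    (hQ : Tendsto Q atTop (𝓝 w)) (h : kernel z w ∈ Complex.slitPlane) :
    Tendsto (fun s => triangleAngle (axisPoint s) (P s) (Q s)) atTop (𝓝 (2 * halfAngle z w)) := by
  have h1 := tendsto_halfAngle_zero (by norm_num) tendsto_exp_neg_mul_axisPoint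
    (tendsto_exp_neg_mul_of_tendsto hP)
  have h2 := tendsto_halfAngle hP hQ h
  have h3 := tendsto_halfAngle_zero (by norm_num) (tendsto_exp_neg_mul_of_tendsto hQ)
    tendsto_exp_neg_mul_axisPoint
  have := ((h1.add h2).add h3).const_mul 2
  simpa [triangleAngle] using this

theorem signedArea_infty_coe_coe (x y : ℝ) :
    signedArea (.inr OnePoint.infty) (.inr (x : OnePoint ℝ)) (.inr (y : OnePoint ℝ)) =
      2 * halfAngle x y := by
  rw [signedArea_infty (A := .inr (x : OnePoint ℝ)) (B := .inr (y : OnePoint ℝ)) (x₁ := x) (y₁ := 0)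
    (x₂ := y) (y₂ := 0) (by rw [projCoord_coe]; simp) (by rw [projCoord_coe]; simp) le_rfl le_rfl]
  simp [halfAngle, kernel]

theorem signedArea_infty_coe_inl (x : ℝ) (w : ℍ) :
    signedArea (.inr OnePoint.infty) (.inr (x : OnePoint ℝ)) (.inl w) = 2 * halfAngle x w := by
  rw [signedArea_infty (A := .inr (x : OnePoint ℝ)) (x₁ := x) (y₁ := 0)
    (by rw [projCoord_coe]; simp) (projCoord_inl w) le_rfl w.im_pos.le]
  simp [halfAngle, kernel]

theorem signedArea_self_outer (A C : ClosedPlane) : signedArea A C A = 0 := by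
  rw [← signedArea_rotate, signedArea_self_right]

theorem tendsto_triangleAngle_smul_const (g : PSL(2, ℝ)) (w : ℍ) :
    Tendsto (fun s => triangleAngle (axisPoint s) (g • axisPoint s : ℍ) w) atTop
      (𝓝 (signedArea (.inr OnePoint.infty) (.inr (g • OnePoint.infty)) (.inl w))) := by
  rcases h : g • (OnePoint.infty : OnePoint ℝ) with _ | x
  · obtain ⟨κ, hκ, h'⟩ := tendsto_smul_axisPoint_of_fixes_infty h
    change Tendsto _ _ (𝓝 (signedArea (.inr OnePoint.infty) (.inr OnePoint.infty) (.inl w)))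
    rw [signedArea_self]
    exact tendsto_triangleAngle_zero hκ.le le_rfl (by linarith) h'
      (tendsto_exp_neg_mul_of_tendsto tendsto_const_nhds)
  · change Tendsto _ _ (𝓝 (signedArea (.inr OnePoint.infty) (.inr (x : OnePoint ℝ)) (.inl w)))
    rw [signedArea_infty_coe_inl]
    refine tendsto_triangleAngle_of_tendsto (tendsto_smul_axisPoint_of_coe h) tendsto_const_nhds ?_
    refine Complex.mem_slitPlane_iff.mpr (Or.inl ?_)
    simp [kernel, w.im_pos]

theorem tendsto_triangleAngle_const (y w : ℍ) :
    Tendsto (fun s => triangleAngle (axisPoint s) y w) atTop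
      (𝓝 (signedArea (.inr OnePoint.infty) (.inl y) (.inl w))) := by
  rw [signedArea_infty_inl]
  exact tendsto_triangleAngle_of_tendsto tendsto_const_nhds tendsto_const_nhds
    (Complex.mem_slitPlane_iff.mpr (Or.inl (kernel_re_pos y w)))

/-- If the two image endpoints are distinct reals, the limiting kernel is nonzero and imaginary, so
the argument is still continuous there. If one is `∞`, rescaling gives limit `0`. Coinciding
endpoints need the separate reduction below. -/
theorem tendsto_triangleAngle_smul_smul (g k : PSL(2, ℝ)) :
    Tendsto (fun s => triangleAngle (axisPoint s) (g • axisPoint s : ℍ) (k • axisPoint s : ℍ)) atTop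
      (𝓝 (signedArea (.inr OnePoint.infty) (.inr (g • OnePoint.infty))
        (.inr (k • OnePoint.infty)))) := by
  have hfix : ∀ g k : PSL(2, ℝ), g • (OnePoint.infty : OnePoint ℝ) = OnePoint.infty →
      Tendsto (fun s => triangleAngle (axisPoint s) (g • axisPoint s : ℍ) (k • axisPoint s : ℍ)) atTop
        (𝓝 0) := by
    intro g k h
    obtain ⟨κ, hκ, h'⟩ := tendsto_smul_axisPoint_of_fixes_infty h
    obtain ⟨μ, hμ, h''⟩ := exists_tendsto_smul_axisPoint k
    exact tendsto_triangleAngle_zero hκ.le hμ (by linarith) h' h''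
  by_cases hgk : g • (OnePoint.infty : OnePoint ℝ) = k • OnePoint.infty
  · rw [hgk, signedArea_self_right]
    -- At a common real endpoint the kernel degenerates to `0`. Applying `g⁻¹` and rotating the
    -- vertices gives a triangle whose second vertex comes from `g⁻¹ * k`, which fixes `∞`.
    have := hfix (g⁻¹ * k) g⁻¹ (by rw [mul_smul, ← hgk, inv_smul_smul])
    refine this.congr fun s => ?_
    rw [← triangleAngle_smul g, mul_smul, smul_inv_smul, smul_inv_smul, triangleAngle_rotate]
  rcases h : g • (OnePoint.infty : OnePoint ℝ) with _ | x
  · change Tendsto _ _ (𝓝 (signedArea (.inr OnePoint.infty) (.inr OnePoint.infty) _))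
    rw [signedArea_self]
    exact hfix g k h
  rcases h' : k • (OnePoint.infty : OnePoint ℝ) with _ | y
  · change Tendsto _ _ (𝓝 (signedArea (.inr OnePoint.infty) _ (.inr OnePoint.infty)))
    rw [signedArea_self_outer]
    obtain ⟨κ, hκ, e⟩ := tendsto_smul_axisPoint_of_fixes_infty h'
    obtain ⟨μ, hμ, e'⟩ := exists_tendsto_smul_axisPoint g
    exact tendsto_triangleAngle_zero hμ hκ.le (by linarith) e' e
  · change Tendsto _ _ (𝓝 (signedArea (.inr OnePoint.infty) (.inr (x : OnePoint ℝ))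
      (.inr (y : OnePoint ℝ))))
    rw [signedArea_infty_coe_coe]
    refine tendsto_triangleAngle_of_tendsto (tendsto_smul_axisPoint_of_coe h)
      (tendsto_smul_axisPoint_of_coe h') ?_
    refine Complex.mem_slitPlane_iff.mpr (Or.inr ?_)
    have hxy : x ≠ y := fun e => hgk (by rw [h, h', e])
    simpa [kernel, sub_eq_zero] using hxy.symm

/-! ### The twist on the closed hyperbolic plane -/

/-- Conjugation by `h` reduces an arbitrary geodesic to the imaginary axis. -/
theorem tendsto_triangleAngle_geodesic (h α β : PSL(2, ℝ)) :
    Tendsto (fun s => triangleAngle (geodesic h s) (α • geodesic h s : ℍ) (β • geodesic h s : ℍ)) atTop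
      (𝓝 (signedArea (h • .inr OnePoint.infty) (α • h • .inr OnePoint.infty)
        (β • h • .inr OnePoint.infty))) := by
  have key := tendsto_triangleAngle_smul_smul (h⁻¹ * α * h) (h⁻¹ * β * h)
  rw [← smul_inr, ← smul_inr, ← signedArea_smul h, ← mul_smul h, ← mul_smul h] at key
  rw [← mul_smul α, ← mul_smul β]
  simp only [mul_assoc, mul_inv_cancel_left] at key ⊢
  refine key.congr fun s => ?_
  rw [← triangleAngle_smul h, geodesic]
  simp only [← mul_smul, mul_inv_cancel_left]

theorem tendsto_triangleAngle_geodesic_const (h α : PSL(2, ℝ)) (w : ℍ) :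
    Tendsto (fun s => triangleAngle (geodesic h s) (α • geodesic h s : ℍ) w) atTop
      (𝓝 (signedArea (h • .inr OnePoint.infty) (α • h • .inr OnePoint.infty) (.inl w))) := by
  have key := tendsto_triangleAngle_smul_const (h⁻¹ * α * h) (h⁻¹ • w)
  rw [← smul_inr, ← signedArea_smul h, ← mul_smul h, smul_inl, smul_inv_smul] at key
  rw [← mul_smul α]
  simp only [mul_assoc, mul_inv_cancel_left] at key ⊢
  refine key.congr fun s => ?_
  rw [← triangleAngle_smul h, geodesic, smul_inv_smul]
  simp only [← mul_smul, mul_inv_cancel_left]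

theorem tendsto_triangleAngle_const_geodesic (h : PSL(2, ℝ)) (y w : ℍ) :
    Tendsto (fun s => triangleAngle y (geodesic h s) w) atTop
      (𝓝 (signedArea (.inl y) (h • .inr OnePoint.infty) (.inl w))) := by
  have key := tendsto_triangleAngle_const (h⁻¹ • w) (h⁻¹ • y)
  rw [← signedArea_smul h, smul_inl, smul_inl, smul_inv_smul, smul_inv_smul, signedArea_rotate] at key
  refine key.congr fun s => ?_
  rw [← triangleAngle_smul h, smul_inv_smul, smul_inv_smul, triangleAngle_rotate, geodesic]

theorem exists_smul_infty_eq (q : OnePoint ℝ) :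
    ∃ h : PSL(2, ℝ), h • (OnePoint.infty : OnePoint ℝ) = q := by
  cases q with
  | infty => exact ⟨1, one_smul _ _⟩
  | coe x =>
    obtain ⟨g, hg⟩ : ∃ g : SL(2, ℝ), (g : Matrix (Fin 2) (Fin 2) ℝ) = !![x, -1; 1, 0] :=
      ⟨⟨!![x, -1; 1, 0], by simp [Matrix.det_fin_two_of]⟩, rfl⟩
    refine ⟨QuotientGroup.mk g, ?_⟩
    rw [mk_smul_infty]
    simp [hg]

/-- Comparison with the base point `i` writes the twist as a constant plus two triangle angles,
whose limits are areas depending only on the ideal endpoint and not on the geodesic. -/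
theorem exists_isTwistAtInfinity (a : UniversalCover PSL(2, ℝ)) (q : OnePoint ℝ) :
    ∃ T, IsTwistAtInfinity a q T := by
  refine ⟨twistInterior a UpperHalfPlane.I + signedArea (.inr q) (a.proj • .inr q)
    (.inl (a.proj • UpperHalfPlane.I)) + signedArea (.inl UpperHalfPlane.I) (.inr q)
    (.inl (a.proj • UpperHalfPlane.I)), ?_⟩
  rintro h rfl
  have h1 := tendsto_triangleAngle_geodesic_const h a.proj (a.proj • UpperHalfPlane.I)
  have h2 := tendsto_triangleAngle_const_geodesic h UpperHalfPlane.I (a.proj • UpperHalfPlane.I)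
  refine ((h1.const_add (twistInterior a UpperHalfPlane.I)).add h2).congr fun s => ?_
  rw [twistInterior_change a (geodesic h s) UpperHalfPlane.I]

theorem isTwistAtInfinity_twist (a : UniversalCover PSL(2, ℝ)) (q : OnePoint ℝ) :
    IsTwistAtInfinity a q (twist a (.inr q)) :=
  Classical.epsilon_spec (exists_isTwistAtInfinity a q)

theorem twist_mul (a b : UniversalCover PSL(2, ℝ)) (p : ClosedPlane) :
    twist (a * b) p = twist a p + twist b p -
      signedArea p (a.proj • p) ((a.proj * b.proj) • p) := by
  rcases p with y | q
  · rw [smul_inl, smul_inl, signedArea_inl]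
    exact twistInterior_mul a b y
  · obtain ⟨h, rfl⟩ := exists_smul_infty_eq q
    have ha := isTwistAtInfinity_twist a _ h rfl
    have hb := isTwistAtInfinity_twist b _ h rfl
    have hab := isTwistAtInfinity_twist (a * b) _ h rfl
    have hlim := (ha.add hb).sub (tendsto_triangleAngle_geodesic h a.proj (a.proj * b.proj))
    refine tendsto_nhds_unique hab (hlim.congr fun s => ?_)
    rw [twistInterior_mul]

/-- Multiplying the commutator by `b * a` avoids computing twists of inverses: the twists of `a` and
`b` enter both `a * b` and `b * a` with the same sum. The last area changes sign because its final
two vertices are exchanged. -/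
theorem twist_commutator (a b : UniversalCover PSL(2, ℝ)) (p : ClosedPlane) :
    twist (a * b * a⁻¹ * b⁻¹) p =
      signedArea p (b.proj • p) ((b.proj * a.proj) • p) -
        signedArea p (a.proj • p) ((a.proj * b.proj) • p) -
        signedArea p ((a.proj * b.proj) • p)
          ((a.proj * b.proj * a.proj⁻¹ * b.proj⁻¹) • p) := by
  have h1 := twist_mul (a * b * a⁻¹ * b⁻¹) (b * a) p
  have h2 := twist_mul a b p
  have h3 := twist_mul b a p
  have e : a * b * a⁻¹ * b⁻¹ * (b * a) = a * b := by group
  rw [← map_mul, e] at h1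
  simp only [map_mul, map_inv] at h1
  rw [signedArea_swap p ((a.proj * b.proj) • p)] at h1
  linarith

theorem abs_signedArea_inl_lt (p : ℍ) (α β : PSL(2, ℝ)) :
    |signedArea (.inl p) (α • .inl p) (β • .inl p)| < Real.pi := by
  rw [smul_inl, smul_inl, signedArea_inl]
  exact abs_triangleAngle_lt _ _ _

theorem abs_signedArea_inr_le (q : OnePoint ℝ) (A B : ClosedPlane) :
    |signedArea (.inr q) A B| ≤ Real.pi := by
  obtain ⟨h, rfl⟩ := exists_smul_infty_eq q
  rw [← smul_inr, ← smul_inv_smul h A, ← smul_inv_smul h B, signedArea_smul]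
  exact abs_signedArea_infty_le _ _

end HypTwist

end

/-- The commutator area formula for the twist function on the closed hyperbolic plane, and the
resulting bounds. -/
theorem mainTheorem4 :
    (∀ (a b : HypTwist.UniversalCover PSL(2, ℝ)) (p : HypTwist.ClosedPlane),
      HypTwist.twist (a * b * a⁻¹ * b⁻¹) p =
        HypTwist.signedArea p (HypTwist.UniversalCover.proj b • p)
            ((HypTwist.UniversalCover.proj b * HypTwist.UniversalCover.proj a) • p)
          - HypTwist.signedArea p (HypTwist.UniversalCover.proj a • p)
            ((HypTwist.UniversalCover.proj a * HypTwist.UniversalCover.proj b) • p)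
          - HypTwist.signedArea p
            ((HypTwist.UniversalCover.proj a * HypTwist.UniversalCover.proj b) • p)
            ((HypTwist.UniversalCover.proj a * HypTwist.UniversalCover.proj b *
              (HypTwist.UniversalCover.proj a)⁻¹ * (HypTwist.UniversalCover.proj b)⁻¹) • p)) ∧
    (∀ (a b : HypTwist.UniversalCover PSL(2, ℝ)) (p : ℍ),
      |HypTwist.twist (a * b * a⁻¹ * b⁻¹) (.inl p)| < 3 * Real.pi) ∧
    (∀ (a b : HypTwist.UniversalCover PSL(2, ℝ)) (p : OnePoint ℝ),
      |HypTwist.twist (a * b * a⁻¹ * b⁻¹) (.inr p)| ≤ 3 * Real.pi) := by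
  refine ⟨HypTwist.twist_commutator, fun a b p => ?_, fun a b p => ?_⟩
  · rw [HypTwist.twist_commutator]
    have h1 := abs_lt.mp (HypTwist.abs_signedArea_inl_lt p b.proj (b.proj * a.proj))
    have h2 := abs_lt.mp (HypTwist.abs_signedArea_inl_lt p a.proj (a.proj * b.proj))
    have h3 := abs_lt.mp (HypTwist.abs_signedArea_inl_lt p (a.proj * b.proj)
      (a.proj * b.proj * a.proj⁻¹ * b.proj⁻¹))
    rw [abs_lt]
    constructor <;> linarith
  · rw [HypTwist.twist_commutator]
    have h1 := abs_le.mp (HypTwist.abs_signedArea_inr_le p (b.proj • .inr p)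
      ((b.proj * a.proj) • .inr p))
    have h2 := abs_le.mp (HypTwist.abs_signedArea_inr_le p (a.proj • .inr p)
      ((a.proj * b.proj) • .inr p))
    have h3 := abs_le.mp (HypTwist.abs_signedArea_inr_le p ((a.proj * b.proj) • .inr p)
      ((a.proj * b.proj * a.proj⁻¹ * b.proj⁻¹) • .inr p))
    rw [abs_le]
    constructor <;> linarith
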